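/- Let $\mathfrak g$ be a finite-dimensional simple Lie algebra over an algebraically closed field of characteristic $0$, $\mathfrak t\subset\mathfrak g$ a Cartan subalgebra, $\Delta$ the root system of $(\mathfrak g,\mathfrak t)$, $\Delta^+$ a set of positive roots with simple roots $\alpha_1,\dots,\alpha_p$ and highest root $\theta$, and $\mathfrak b=\mathfrak t\oplus\bigoplus_{\gamma\in\Delta^+}\mathfrak g_\gamma$ the corresponding Borel subalgebra. Let $V=\bigoplus_i\mathbb Q\alpha_i$ with a $W$-invariant inner product $(\ ,\ )$, let $\Delta^+_l$ be the set of long positive roots (all positive roots, in the simply-laced case), and extend $(\ ,\ )$ to $\widehat V=V\oplus\mathbb Q\delta\oplus\mathbb Q\lambda$ by $(\delta,V)=(\lambda,V)=(\delta,\delta)=(\lambda,\lambda)=0$, $(\delta,\lambda)=1$. Put $\alpha_0=\delta-\theta$, let $s_i$ be the reflection of $\widehat V$ in $\alpha_i$ ($0\le i\le p$), $W=\langle s_1,\dots,s_p\rangle$ the finite Weyl group, $\widehat W=\langle s_0,s_1,\dots,s_p\rangle$ the affine Weyl group, and $\widehat\Delta^+=\Delta^+\cup\{\gamma+k\delta\mid\gamma\in\Delta,\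 k\ge1\}$. For $w\in\widehat W$ put $\widehat N(w)=\{a\in\widehat\Delta^+\mid w(a)\in-\widehat\Delta^+\}$; $w$ is called minuscule if $\widehat N(w)=\{\delta-\gamma\mid\gamma\in I\}$ for some $I\subset\Delta^+$, and then $I_w=\{\gamma\in\Delta^+\mid\delta-\gamma\in\widehat N(w)\}$. A (combinatorial) Abelian ideal is a subset $I\subset\Delta^+$ such that $\mu+\nu\notin\Delta$ for all $\mu,\nu\in I$, and such that $\gamma\in I$, $\nu\in\Delta^+$, $\gamma+\nu\in\Delta$ imply $\gamma+\nu\in I$; it is nontrivial if $I\neq\varnothing$. The map $w\mapsto I_w$ is a bijection from the minuscule elements $w\ne1$ of $\widehat W$ onto the nontrivial Abelian ideals. For $\mu\in\Delta^+_l$ let $\mathfrak{Ab}_\mu$ be the set of all nontrivial Abelian ideals $I_w$ ($w$ minuscule) with $w(\alpha_0)+\delta=\mu$, and let $I(\mu)_{\min}$ denote the least element of $\mathfrak{Ab}_\mu$ with respect to inclusion. Let $\mathcal H=\{\gamma\in\Delta^+\mid(\theta,\gamma)>0\}$ and let $\mathfrak h=\bigoplus_{\gamma\in\mathcal H}\mathfrak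 g_\gamma$ be the Heisenberg subalgebra. For every minuscule $w\neq1$ (that is, for every nontrivial Abelian ideal $I_w$) the following are equivalent: (i) $I_w=I(\mu)_{\min}$ for some $\mu\in\Delta^+_l$; (ii) $I_w\subset\mathcal H$; (iii) $w=w's_0$ for some $w'\in W$. Moreover, $I(\mu)_{\min}$ exists for every $\mu\in\Delta^+_l$, the map $\mu\mapsto I(\mu)_{\min}$ is a bijection from $\Delta^+_l$ onto the set of nontrivial Abelian ideals contained in $\mathcal H$, and $\mu\mapsto\bigoplus_{\gamma\in I(\mu)_{\min}}\mathfrak g_\gamma$ is a bijection from $\Delta^+_l$ onto the set of nonzero Abelian ideals of $\mathfrak b$ contained in $\mathfrak h$. -/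

import Mathlib

namespace AbelianIdeals

section Combinatorial

variable {ι V N : Type*} [AddCommGroup V] [Module ℚ V] [AddCommGroup N] [Module ℚ N]
  {P : RootPairing ι ℚ V N}

/-- The space `V̂ = V ⊕ ℚδ ⊕ ℚλ`; the triple `(v, s, t)` stands for `v + sδ + tλ`. -/
abbrev AffineSpace (V : Type*) : Type _ := V × ℚ × ℚ

/-- The element `δ` of `V̂`. -/
def delta : AffineSpace V := (0, 1, 0)

/-- A vector of `V`, seen in `V̂`. -/
def emb (v : V) : AffineSpace V := (v, 0, 0)

/-- The extension of the inner product from `V` to `V̂`: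
`(δ, V) = (λ, V) = (δ, δ) = (λ, λ) = 0` and `(δ, λ) = 1`. -/
def affineForm (B : P.RootPositiveForm ℚ) : LinearMap.BilinForm ℚ (AffineSpace V) :=
  LinearMap.mk₂ ℚ (fun x y ↦ B.form x.1 y.1 + (x.2.1 * y.2.2 + x.2.2 * y.2.1))
    (by intro x y z; simp; ring) (by intro c x y; simp; ring)
    (by intro x y z; simp; ring) (by intro c x y; simp; ring)

/-- The reflection `x ↦ x - (2 (a, x) / (a, a)) a` of `V̂` in a non-isotropic vector `a`. -/
noncomputable def affineReflection (B : P.RootPositiveForm ℚ) (a : AffineSpace V)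
    (ha : affineForm B a a ≠ 0) : AffineSpace V ≃ₗ[ℚ] AffineSpace V :=
  Module.reflection (x := a) (f := (2 / affineForm B a a) • affineForm B a)
    (by simp [div_mul_cancel₀ _ ha])

/-- The affine simple root `α₀ = δ - θ`. -/
def alphaZero (P : RootPairing ι ℚ V N) (θ : ι) : AffineSpace V := delta - emb (P.root θ)

lemma affineForm_emb_ne_zero (B : P.RootPositiveForm ℚ) (i : ι) :
    affineForm B (emb (P.root i)) (emb (P.root i)) ≠ 0 := by
  simpa [affineForm, emb] using B.form_apply_root_ne_zero i

lemma affineForm_alphaZero_ne_zero (B : P.RootPositiveForm ℚ) (θ : ι) :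
    affineForm B (alphaZero P θ) (alphaZero P θ) ≠ 0 := by
  simpa [affineForm, emb, alphaZero, delta] using B.form_apply_root_ne_zero θ

/-- The reflection in the root `P.root i`, acting on `V̂`. -/
noncomputable def refl (B : P.RootPositiveForm ℚ) (i : ι) : AffineSpace V ≃ₗ[ℚ] AffineSpace V :=
  affineReflection B (emb (P.root i)) (affineForm_emb_ne_zero B i)

/-- The affine simple reflection `s₀`, the reflection in `α₀`. -/
noncomputable def reflZero (B : P.RootPositiveForm ℚ) (θ : ι) :
    AffineSpace V ≃ₗ[ℚ] AffineSpace V :=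
  affineReflection B (alphaZero P θ) (affineForm_alphaZero_ne_zero B θ)

/-- The finite Weyl group `W`, generated by the simple reflections `s₁, …, s_p`, acting on `V̂`. -/
def finiteWeyl (B : P.RootPositiveForm ℚ) (b : P.Base) :
    Subgroup (AffineSpace V ≃ₗ[ℚ] AffineSpace V) :=
  Subgroup.closure (refl B '' (b.support : Set ι))

/-- The affine Weyl group `Ŵ`, generated by the simple reflections `s₀, s₁, …, s_p`. -/
def affineWeyl (B : P.RootPositiveForm ℚ) (b : P.Base) (θ : ι) :
    Subgroup (AffineSpace V ≃ₗ[ℚ] AffineSpace V) :=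
  Subgroup.closure (insert (reflZero B θ) (refl B '' (b.support : Set ι)))

/-- The positive affine (real) roots: `Δ⁺ ∪ {γ + kδ | γ ∈ Δ, k ≥ 1}`. -/
def affinePos (b : P.Base) : Set (AffineSpace V) :=
  {a | ∃ i : ι, b.IsPos i ∧ a = emb (P.root i)} ∪
    {a | ∃ (i : ι) (k : ℤ), 1 ≤ k ∧ a = emb (P.root i) + (k : ℚ) • delta}

/-- The set `N̂(w)` of positive affine roots that `w` makes negative. -/
def inversionSet (b : P.Base) (w : AffineSpace V ≃ₗ[ℚ] AffineSpace V) : Set (AffineSpace V) :=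
  {a | a ∈ affinePos b ∧ -(w a) ∈ affinePos b}

/-- `w ∈ Ŵ` is minuscule if `N̂(w) = {δ - γ | γ ∈ I}` for a set `I` of positive roots. -/
def IsMinuscule (B : P.RootPositiveForm ℚ) (b : P.Base) (θ : ι)
    (w : AffineSpace V ≃ₗ[ℚ] AffineSpace V) : Prop :=
  w ∈ affineWeyl B b θ ∧
    ∃ I : Set ι, (∀ γ ∈ I, b.IsPos γ) ∧ inversionSet b w = (fun γ ↦ delta - emb (P.root γ)) '' I

/-- The set `I_w = {γ ∈ Δ⁺ | δ - γ ∈ N̂(w)}`. -/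
def idealOf (b : P.Base) (w : AffineSpace V ≃ₗ[ℚ] AffineSpace V) : Set ι :=
  {γ | b.IsPos γ ∧ delta - emb (P.root γ) ∈ inversionSet b w}

/-- Combinatorial Abelian ideals: sets `I` of positive roots such that no sum of two members of `I`
is a root and such that `γ + ν ∈ I` whenever `γ ∈ I`, `ν ∈ Δ⁺` and `γ + ν ∈ Δ`. -/
structure IsAbelianIdeal (b : P.Base) (I : Set ι) : Prop where
  pos : ∀ γ ∈ I, b.IsPos γ
  abelian : ∀ μ ∈ I, ∀ ν ∈ I, P.root μ + P.root ν ∉ Set.range P.root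
  ideal : ∀ γ ∈ I, ∀ ν, b.IsPos ν → ∀ κ, P.root κ = P.root γ + P.root ν → κ ∈ I

/-- The set of nontrivial (that is, nonempty) combinatorial Abelian ideals. -/
def nontrivialIdeals (b : P.Base) : Set (Set ι) := {I | IsAbelianIdeal b I ∧ I.Nonempty}

/-- The set of long positive roots (all positive roots, if there is one root length only). -/
def longPos (B : P.RootPositiveForm ℚ) (b : P.Base) : Set ι :=
  {μ | b.IsPos μ ∧ ∀ j, B.form (P.root j) (P.root j) ≤ B.form (P.root μ) (P.root μ)}

/-- `θ` is the highest root: every `θ - γ`, `γ ∈ Δ`, is a sum of simple roots. -/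
def IsHighestRoot (b : P.Base) (θ : ι) : Prop :=
  ∀ γ, P.root θ - P.root γ ∈ AddSubmonoid.closure (P.root '' (b.support : Set ι))

/-- The fibre over `μ` of the rootlet map `τ(I_w) = w(α₀) + δ` on nontrivial Abelian ideals. -/
def rootletFibre (B : P.RootPositiveForm ℚ) (b : P.Base) (θ μ : ι) : Set (Set ι) :=
  {I | I ∈ nontrivialIdeals b ∧
    ∃ w, IsMinuscule B b θ w ∧ idealOf b w = I ∧ w (alphaZero P θ) + delta = emb (P.root μ)}

/-- `I` is `I(μ)_min`, the minimal element (for inclusion) of the fibre over `μ` of the rootlet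
map. -/
def IsMinIdeal (B : P.RootPositiveForm ℚ) (b : P.Base) (θ μ : ι) (I : Set ι) : Prop :=
  IsLeast (rootletFibre B b θ μ) I

/-- The Heisenberg root set `{γ ∈ Δ⁺ | (θ, γ) > 0}`. -/
def heisenbergRoots (B : P.RootPositiveForm ℚ) (b : P.Base) (θ : ι) : Set ι :=
  {γ | b.IsPos γ ∧ 0 < B.form (P.root θ) (P.root γ)}

end Combinatorial

section Geometric

open LieAlgebra LieAlgebra.IsKilling LieModule

variable {K L : Type*} [Field K] [CharZero K] [LieRing L] [LieAlgebra K L] [FiniteDimensional K L]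
  [IsKilling K L] (H : LieSubalgebra K L) [H.IsCartanSubalgebra] [IsTriangularizable K H L]

/-- The root system of `(L, H)` over `ℚ`; it lives in the `ℚ`-span of the roots. -/
noncomputable abbrev ratRootSystem := (rootSystem H).restrictScalarsRat

/-- The sum of the root spaces of the roots in `I`. -/
def rootSpaceSum (I : Set H.root) : Submodule K L :=
  ⨆ γ ∈ I, (rootSpace H (γ.1 : H → K)).toSubmodule

variable {H}

lemma lie_mem_rootSpaceSum (b : (ratRootSystem H).Base) {α β : H.root}
    (hα : b.IsPos α) (hβ : b.IsPos β) {x y : L}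
    (hx : x ∈ rootSpace H (α.1 : H → K)) (hy : y ∈ rootSpace H (β.1 : H → K)) :
    ⁅x, y⁆ ∈ rootSpaceSum H {γ | b.IsPos γ} := by
  have hxy : ⁅x, y⁆ ∈ rootSpace H ((α.1 : H → K) + (β.1 : H → K)) :=
    lie_mem_genWeightSpace_of_mem_genWeightSpace hx hy
  by_cases h0 : rootSpace H ((α.1 : H → K) + (β.1 : H → K)) = ⊥
  · rw [h0, LieSubmodule.mem_bot] at hxy
    rw [hxy]
    exact zero_mem _
  let κ : Weight K H L := ⟨(α.1 : H → K) + (β.1 : H → K), h0⟩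
  by_cases hκ : κ.IsZero
  · have h : (α.1 : H → K) + (β.1 : H → K) = 0 := hκ
    have hr : (ratRootSystem H).root α = -(ratRootSystem H).root β := by
      ext z
      exact eq_neg_of_add_eq_zero_left (congrFun h z)
    let := (ratRootSystem H).indexNeg
    have hαβ : α = -β := (ratRootSystem H).root.injective (by simpa using hr)
    have := (RootPairing.Base.IsPos.neg_iff_not b β).mp (hαβ ▸ hα)
    exact absurd hβ this
  · let γ : H.root := ⟨κ, by simpa using hκ⟩
    have hγ : b.IsPos γ := hα.add hβ (by ext z; rfl)
    exact Submodule.mem_iSup_of_mem γ (Submodule.mem_iSup_of_mem hγ hxy)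

/-- The Borel subalgebra `H ⊕ ⨁_{γ ∈ Δ⁺} L_γ`. -/
def borel (b : (ratRootSystem H).Base) : LieSubalgebra K L where
  __ := H.toSubmodule ⊔ rootSpaceSum H {γ | b.IsPos γ}
  lie_mem' := by
    have aux : ∀ x : L, (∀ β : H.root, b.IsPos β → ∀ y ∈ rootSpace H (β.1 : H → K),
          ⁅x, y⁆ ∈ rootSpaceSum H {γ | b.IsPos γ}) →
        ∀ y ∈ rootSpaceSum H {γ | b.IsPos γ}, ⁅x, y⁆ ∈ rootSpaceSum H {γ | b.IsPos γ} := by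
      intro x hx
      have : rootSpaceSum H {γ | b.IsPos γ} ≤
          (rootSpaceSum H {γ | b.IsPos γ}).comap (LieAlgebra.ad K L x) := by
        exact iSup₂_le fun β hβ y hy ↦ hx β hβ y hy
      exact fun y hy ↦ this hy
    have cartan : ∀ h ∈ H, ∀ y ∈ rootSpaceSum H {γ | b.IsPos γ},
        ⁅h, y⁆ ∈ rootSpaceSum H {γ | b.IsPos γ} := by
      intro h hh
      refine aux h fun β hβ y hy ↦ ?_
      exact Submodule.mem_iSup_of_mem β (Submodule.mem_iSup_of_mem hβ
        ((rootSpace H (β.1 : H → K)).lie_mem (x := (⟨h, hh⟩ : H)) hy))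
    have nil : ∀ x ∈ rootSpaceSum H {γ | b.IsPos γ}, ∀ y ∈ rootSpaceSum H {γ | b.IsPos γ},
        ⁅x, y⁆ ∈ rootSpaceSum H {γ | b.IsPos γ} := by
      intro x hx
      refine aux x fun β hβ y hy ↦ ?_
      rw [← lie_skew]
      exact neg_mem (aux y (fun α hα z hz ↦ lie_mem_rootSpaceSum b hβ hα hy hz) x hx)
    intro u v hu hv
    obtain ⟨h, hh, x, hx, rfl⟩ := Submodule.mem_sup.mp hu
    obtain ⟨h', hh', y, hy, rfl⟩ := Submodule.mem_sup.mp hv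
    rw [add_lie, lie_add, lie_add, add_assoc]
    refine Submodule.add_mem_sup (H.lie_mem hh hh') (add_mem (cartan h hh y hy) (add_mem ?_ ?_))
    · rw [← lie_skew]
      exact neg_mem (cartan h' hh' x hx)
    · exact nil x hx y hy

end Geometric

end AbelianIdeals

namespace AbelianIdeals

set_option linter.unusedSectionVars false

/-! ### Affine roots, their reflections, and the isometries that permute them. -/

section AffineRoots

variable {ι V N : Type*} [AddCommGroup V] [Module ℚ V] [AddCommGroup N] [Module ℚ N]
  {P : RootPairing ι ℚ V N}

/-! Everything is read off from inversion sets, graded by level, the coefficient of δ. One linear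
functional, the affine height `affHt`, cuts out the positive affine roots. The usual Coxeter
arguments (a simple reflection makes only its own root negative; exchange) then show that an element
of the affine Weyl group is determined by its inversions (`inversionSet_injOn`). A minuscule w has
all its inversions at level 1, which forces I_w to be an Abelian ideal. Conversely, an Abelian ideal
is built up one root at a time, because w(δ - γ) is simple whenever I_w = I \ {γ}
(`map_delta_sub_mem_simpleRoots`).

The group W preserves levels, and s₀ raises the level of γ + kδ by ⟨γ, θ^∨⟩. For γ ≠ θ in the
Heisenberg set this pairing is 1, so s₀ takes δ - γ to θ - γ, at level 0. Hence, for w ≠ 1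
minuscule, I_w lies in the Heisenberg set exactly when w = w's₀ with w' in W, and then its rootlet
is w'(θ). Such a w' is the unique element of W that sends θ to μ and keeps the positive roots
orthogonal to θ positive (`eq_of_map_highestRoot_eq`). It exists for every long positive μ, because
W is transitive on long roots, and it does give a minuscule element (`isMinuscule_mul_reflZero`).

For minimality, roots of I_w outside the Heisenberg set are orthogonal to θ. Peeling them off
composes w with reflections that do not move the image of α₀, so the Heisenberg part of I_w stays in
the same fibre (`exists_inter_heisenbergRoots`). By uniqueness of w' all members of a fibre have the
same Heisenberg part, which is therefore the least member.

On the Lie algebra side, root spaces are lines and [L_α, L_β] ≠ 0 when α + β is a root. Abelian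
ideals of the Borel subalgebra inside the Heisenberg subalgebra are thus exactly the sums of root
spaces over combinatorial ones (`exists_equiv_lieIdeal`). -/

@[simp] lemma emb_fst (v : V) : (emb v).1 = v := rfl
@[simp] lemma emb_snd (v : V) : (emb v).2 = 0 := rfl
@[simp] lemma delta_fst : (delta : AffineSpace V).1 = 0 := rfl
@[simp] lemma delta_snd_fst : (delta : AffineSpace V).2.1 = 1 := rfl
@[simp] lemma delta_snd_snd : (delta : AffineSpace V).2.2 = 0 := rfl

lemma emb_add (v w : V) : emb (v + w) = emb v + emb w := by simp [emb]
lemma emb_sub (v w : V) : emb (v - w) = emb v - emb w := by simp [emb]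
lemma emb_neg (v : V) : emb (-v) = -emb v := by simp [emb]

lemma emb_injective : Function.Injective (emb : V → AffineSpace V) :=
  fun _ _ h ↦ congrArg Prod.fst h

lemma affineForm_apply (B : P.RootPositiveForm ℚ) (x y : AffineSpace V) :
    affineForm B x y = B.form x.1 y.1 + (x.2.1 * y.2.2 + x.2.2 * y.2.1) := rfl

@[simp] lemma affineForm_emb_emb (B : P.RootPositiveForm ℚ) (v w : V) :
    affineForm B (emb v) (emb w) = B.form v w := by
  simp [affineForm_apply]

@[simp] lemma affineForm_delta_emb (B : P.RootPositiveForm ℚ) (v : V) :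
    affineForm B delta (emb v) = 0 := by
  simp [affineForm_apply]

@[simp] lemma affineForm_emb_delta (B : P.RootPositiveForm ℚ) (v : V) :
    affineForm B (emb v) delta = 0 := by
  simp [affineForm_apply]

@[simp] lemma affineForm_delta_delta (B : P.RootPositiveForm ℚ) :
    affineForm B delta delta = 0 := by
  simp [affineForm_apply]

lemma affineForm_comm (B : P.RootPositiveForm ℚ) (x y : AffineSpace V) :
    affineForm B x y = affineForm B y x := by
  rw [affineForm_apply, affineForm_apply, show B.form x.1 y.1 = B.form y.1 x.1 by
    simpa using B.symm.eq x.1 y.1]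
  ring

open Classical in
/-- The reflection of `V̂` in a vector, with the value `1` at isotropic vectors. -/
noncomputable def affRefl (B : P.RootPositiveForm ℚ) (a : AffineSpace V) :
    AffineSpace V ≃ₗ[ℚ] AffineSpace V :=
  if ha : affineForm B a a ≠ 0 then affineReflection B a ha else 1

lemma affRefl_apply (B : P.RootPositiveForm ℚ) (a x : AffineSpace V) :
    affRefl B a x = x - (2 / affineForm B a a * affineForm B a x) • a := by
  unfold affRefl
  split_ifs with h
  · simp [affineReflection, Module.reflection_apply]
  · rw [not_not] at h
    simp [h]

lemma refl_eq_affRefl (B : P.RootPositiveForm ℚ) (i : ι) :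
    refl B i = affRefl B (emb (P.root i)) := by
  rw [affRefl, dif_pos (affineForm_emb_ne_zero B i), refl]

lemma reflZero_eq_affRefl (B : P.RootPositiveForm ℚ) (θ : ι) :
    reflZero B θ = affRefl B (alphaZero P θ) := by
  rw [affRefl, dif_pos (affineForm_alphaZero_ne_zero B θ), reflZero]

lemma affRefl_affRefl (B : P.RootPositiveForm ℚ) (a x : AffineSpace V) :
    affRefl B a (affRefl B a x) = x := by
  unfold affRefl
  split_ifs with h
  · exact Module.involutive_reflection _ x
  · rfl

lemma affRefl_mul_self (B : P.RootPositiveForm ℚ) (a : AffineSpace V) :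
    affRefl B a * affRefl B a = 1 :=
  LinearEquiv.ext (affRefl_affRefl B a)

lemma affRefl_apply_self (B : P.RootPositiveForm ℚ) {a : AffineSpace V}
    (ha : affineForm B a a ≠ 0) : affRefl B a a = -a := by
  rw [affRefl_apply, div_mul_cancel₀ _ ha, two_smul]
  abel

lemma affRefl_apply_of_orthogonal (B : P.RootPositiveForm ℚ) {a x : AffineSpace V}
    (h : affineForm B a x = 0) : affRefl B a x = x := by
  simp [affRefl_apply, h]

lemma affineForm_affRefl (B : P.RootPositiveForm ℚ) (a x y : AffineSpace V) :
    affineForm B (affRefl B a x) (affRefl B a y) = affineForm B x y := by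
  by_cases h : affineForm B a a = 0
  · simp [affRefl, h]
  · simp only [affRefl_apply, map_sub, map_smul, LinearMap.sub_apply, LinearMap.smul_apply,
      smul_eq_mul, affineForm_comm B x a]
    field_simp
    ring

/-- The real affine roots `γ + kδ`. -/
def affRoots (P : RootPairing ι ℚ V N) : Set (AffineSpace V) :=
  {a | ∃ (i : ι) (k : ℤ), a = emb (P.root i) + (k : ℚ) • delta}

lemma emb_root_mem_affRoots (i : ι) : emb (P.root i) ∈ affRoots P := ⟨i, 0, by simp⟩

lemma delta_sub_mem_affRoots (i : ι) : delta - emb (P.root i) ∈ affRoots P :=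
  ⟨P.reflectionPerm i i, 1, by simp [emb_neg]; abel⟩

lemma neg_mem_affRoots {a : AffineSpace V} (ha : a ∈ affRoots P) : -a ∈ affRoots P := by
  obtain ⟨i, k, rfl⟩ := ha
  exact ⟨P.reflectionPerm i i, -k, by simp [emb_neg]; abel⟩

lemma affineForm_self_of_affRoot (B : P.RootPositiveForm ℚ) (i : ι) (k : ℚ) :
    affineForm B (emb (P.root i) + k • delta) (emb (P.root i) + k • delta) =
      B.form (P.root i) (P.root i) := by
  simp

lemma affineForm_self_ne_zero (B : P.RootPositiveForm ℚ) {a : AffineSpace V}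
    (ha : a ∈ affRoots P) : affineForm B a a ≠ 0 := by
  obtain ⟨i, k, rfl⟩ := ha
  rw [affineForm_self_of_affRoot]
  exact B.form_apply_root_ne_zero i

lemma form_root_pos (B : P.RootPositiveForm ℚ) (i : ι) : 0 < B.form (P.root i) (P.root i) := by
  obtain ⟨s, hs, h⟩ := B.exists_pos_eq i
  rw [← h]
  exact hs

lemma form_comm (B : P.RootPositiveForm ℚ) (v w : V) : B.form v w = B.form w v := by
  simpa using B.symm.eq v w

section Crystallographic

variable [P.IsCrystallographic]

lemma two_mul_form_root_root (B : P.RootPositiveForm ℚ) (i j : ι) :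
    2 * B.form (P.root i) (P.root j) = P.pairingIn ℤ i j * B.form (P.root j) (P.root j) := by
  rw [B.two_mul_apply_root_root, ← P.algebraMap_pairingIn ℤ i j]
  rfl

lemma form_root_root_pos_iff (B : P.RootPositiveForm ℚ) (i j : ι) :
    0 < B.form (P.root i) (P.root j) ↔ 0 < P.pairingIn ℤ i j := by
  have h := two_mul_form_root_root B i j
  rw [← mul_pos_iff_of_pos_left (zero_lt_two (α := ℚ)), h,
    mul_pos_iff_of_pos_right (form_root_pos B j), Int.cast_pos]

lemma form_root_root_eq_zero_iff (B : P.RootPositiveForm ℚ) (i j : ι) :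
    B.form (P.root i) (P.root j) = 0 ↔ P.pairingIn ℤ i j = 0 := by
  have h := two_mul_form_root_root B i j
  have hj := form_root_pos B j
  constructor
  · intro h0
    rw [h0, mul_zero] at h
    simpa [hj.ne'] using h.symm
  · intro h0
    rw [h0] at h
    simpa using h

/-- Since δ is isotropic and orthogonal to V, only the finite parts enter the coefficient. Its
integrality keeps the level an integer. -/
lemma affRefl_affRoot_apply (B : P.RootPositiveForm ℚ) (i j : ι) (k m : ℤ) :
    affRefl B (emb (P.root i) + (k : ℚ) • delta) (emb (P.root j) + (m : ℚ) • delta) =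
      emb (P.root (P.reflectionPerm i j)) + ((m - P.pairingIn ℤ j i * k : ℤ) : ℚ) • delta := by
  have h := two_mul_form_root_root B j i
  have hi := (form_root_pos B i).ne'
  have key : 2 / B.form (P.root i) (P.root i) * B.form (P.root i) (P.root j) =
      P.pairingIn ℤ j i := by
    rw [form_comm B (P.root i) (P.root j), div_mul_eq_mul_div, h, mul_div_assoc, div_self hi, mul_one]
  rw [affRefl_apply, affineForm_self_of_affRoot]
  simp only [map_add, map_smul, LinearMap.add_apply, LinearMap.smul_apply, affineForm_emb_emb,
    affineForm_delta_emb, affineForm_emb_delta, affineForm_delta_delta, smul_zero, add_zero]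
  rw [key, P.root_reflectionPerm, P.reflection_apply_root' ℤ, emb_sub]
  have : emb (P.pairingIn ℤ j i • P.root i) = (P.pairingIn ℤ j i : ℚ) • emb (P.root i) := by
    simp [emb, Int.cast_smul_eq_zsmul]
  rw [this]
  push_cast
  module

lemma affRefl_mem_affRoots (B : P.RootPositiveForm ℚ) {a x : AffineSpace V}
    (ha : a ∈ affRoots P) (hx : x ∈ affRoots P) : affRefl B a x ∈ affRoots P := by
  obtain ⟨i, k, rfl⟩ := ha
  obtain ⟨j, m, rfl⟩ := hx
  exact ⟨_, _, affRefl_affRoot_apply B i j k m⟩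

end Crystallographic

/-- The linear isometries of `V̂` that fix `δ` and permute the real affine roots. -/
def affAut (B : P.RootPositiveForm ℚ) : Subgroup (AffineSpace V ≃ₗ[ℚ] AffineSpace V) where
  carrier := {w | (∀ x y, affineForm B (w x) (w y) = affineForm B x y) ∧ w delta = delta ∧
    ∀ a, w a ∈ affRoots P ↔ a ∈ affRoots P}
  mul_mem' := by
    rintro u v ⟨hu, hu', hu''⟩ ⟨hv, hv', hv''⟩
    exact ⟨fun x y ↦ by simp [hu, hv], by simp [hu', hv'], fun a ↦ by simp [hu'', hv'']⟩
  one_mem' := ⟨fun x y ↦ rfl, rfl, fun a ↦ Iff.rfl⟩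
  inv_mem' := by
    rintro u ⟨hu, hu', hu''⟩
    refine ⟨fun x y ↦ ?_, ?_, fun a ↦ ?_⟩
    · rw [← hu]
      simp
    · apply u.injective
      simp [hu']
    · rw [← hu'']
      simp

section
variable {B : P.RootPositiveForm ℚ} {w : AffineSpace V ≃ₗ[ℚ] AffineSpace V}

lemma affineForm_map (hw : w ∈ affAut B) (x y : AffineSpace V) :
    affineForm B (w x) (w y) = affineForm B x y := hw.1 x y

lemma map_delta (hw : w ∈ affAut B) : w delta = delta := hw.2.1

lemma map_mem_affRoots (hw : w ∈ affAut B) {a : AffineSpace V} :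
    w a ∈ affRoots P ↔ a ∈ affRoots P := hw.2.2 a

lemma affRefl_map (hw : w ∈ affAut B) (a : AffineSpace V) :
    affRefl B (w a) * w = w * affRefl B a := by
  ext1 x
  simp [affRefl_apply, affineForm_map hw]

lemma affRefl_mem_affAut [P.IsCrystallographic] (B : P.RootPositiveForm ℚ) {a : AffineSpace V}
    (ha : a ∈ affRoots P) : affRefl B a ∈ affAut B := by
  refine ⟨affineForm_affRefl B a, ?_, fun x ↦ ⟨fun h ↦ ?_, affRefl_mem_affRoots B ha⟩⟩
  · apply affRefl_apply_of_orthogonal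
    obtain ⟨i, k, rfl⟩ := ha
    simp
  · simpa [affRefl_affRefl] using affRefl_mem_affRoots B ha h

end

/-- The affine simple roots. -/
def simpleRoots (b : P.Base) (θ : ι) : Set (AffineSpace V) :=
  insert (alphaZero P θ) ((fun i ↦ emb (P.root i)) '' b.support)

lemma simpleRoots_subset (b : P.Base) (θ : ι) : simpleRoots b θ ⊆ affRoots P := by
  rintro a (rfl | ⟨i, -, rfl⟩)
  · exact delta_sub_mem_affRoots θ
  · exact emb_root_mem_affRoots i

lemma affineWeyl_eq (B : P.RootPositiveForm ℚ) (b : P.Base) (θ : ι) :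
    affineWeyl B b θ = Subgroup.closure (affRefl B '' simpleRoots b θ) := by
  rw [affineWeyl, simpleRoots, Set.image_insert_eq, Set.image_image, reflZero_eq_affRefl]
  congr
  ext1 i
  exact refl_eq_affRefl B i

lemma affRefl_mem_affineWeyl (B : P.RootPositiveForm ℚ) {b : P.Base} {θ : ι} {a : AffineSpace V}
    (ha : a ∈ simpleRoots b θ) : affRefl B a ∈ affineWeyl B b θ := by
  rw [affineWeyl_eq]
  exact Subgroup.subset_closure ⟨a, ha, rfl⟩

lemma affineWeyl_le_affAut [P.IsCrystallographic] (B : P.RootPositiveForm ℚ) (b : P.Base) (θ : ι) :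
    affineWeyl B b θ ≤ affAut B := by
  rw [affineWeyl_eq, Subgroup.closure_le]
  rintro - ⟨a, ha, rfl⟩
  exact affRefl_mem_affAut B (simpleRoots_subset b θ ha)

lemma finiteWeyl_le_affineWeyl (B : P.RootPositiveForm ℚ) (b : P.Base) (θ : ι) :
    finiteWeyl B b ≤ affineWeyl B b θ :=
  Subgroup.closure_mono (Set.subset_insert _ _)

lemma finiteWeyl_le_affAut [P.IsCrystallographic] (B : P.RootPositiveForm ℚ) (b : P.Base) :
    finiteWeyl B b ≤ affAut B := by
  rw [finiteWeyl, Subgroup.closure_le]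
  rintro - ⟨i, -, rfl⟩
  rw [refl_eq_affRefl]
  exact affRefl_mem_affAut B (emb_root_mem_affRoots i)

end AffineRoots

/-! ### Heights, positivity of affine roots, and simple reflections. -/

section Positivity

variable {ι V N : Type*} [Finite ι] [AddCommGroup V] [Module ℚ V] [AddCommGroup N] [Module ℚ N]
  {P : RootPairing ι ℚ V N} [P.IsRootSystem] [P.IsCrystallographic]
  {B : P.RootPositiveForm ℚ} {b : P.Base} {θ : ι}

/-- The height, as a linear functional on `V`. -/
noncomputable def htFun (b : P.Base) : V →ₗ[ℚ] ℚ :=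
  b.toWeightBasis.constr ℚ fun _ ↦ (1 : ℚ)

lemma htFun_of_mem_support {i : ι} (hi : i ∈ b.support) : htFun b (P.root i) = 1 := by
  have := b.toWeightBasis.constr_basis ℚ (fun _ ↦ (1 : ℚ)) ⟨i, hi⟩
  rwa [b.toWeightBasis_apply] at this

lemma htFun_root (i : ι) : htFun b (P.root i) = b.height i := by
  obtain ⟨f, -, -, hf⟩ := b.exists_root_eq_sum_int i
  rw [RootPairing.Base.height_eq_sum hf, hf, map_sum, Int.cast_sum]
  refine Finset.sum_congr rfl fun j hj ↦ ?_
  rw [map_zsmul, htFun_of_mem_support hj]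
  simp

lemma isPos_iff_htFun {i : ι} : b.IsPos i ↔ 0 < htFun b (P.root i) := by
  rw [htFun_root, b.isPos_iff, Int.cast_pos]

lemma isPos_reflectionPerm_self {i : ι} : b.IsPos (P.reflectionPerm i i) ↔ ¬ b.IsPos i := by
  have := b.height_ne_zero i
  rw [isPos_iff_htFun, isPos_iff_htFun, P.root_reflectionPerm, P.reflection_apply_self, map_neg,
    htFun_root]
  simp only [Left.neg_pos_iff, Int.cast_lt_zero, Int.cast_pos]
  omega

lemma htFun_nonneg_of_mem_closure {v : V}
    (hv : v ∈ AddSubmonoid.closure (P.root '' (b.support : Set ι))) : 0 ≤ htFun b v := by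
  induction hv using AddSubmonoid.closure_induction with
  | mem x hx =>
    obtain ⟨i, hi, rfl⟩ := hx
    rw [htFun_of_mem_support hi]
    exact zero_le_one
  | zero => simp
  | add x y _ _ hx hy => rw [map_add]; exact add_nonneg hx hy

lemma IsHighestRoot.htFun_le (hθ : IsHighestRoot b θ) (i : ι) :
    htFun b (P.root i) ≤ htFun b (P.root θ) := by
  simpa using htFun_nonneg_of_mem_closure (hθ i)

lemma IsHighestRoot.neg_htFun_le (hθ : IsHighestRoot b θ) (i : ι) :
    -htFun b (P.root θ) ≤ htFun b (P.root i) := by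
  have := hθ.htFun_le (P.reflectionPerm i i)
  rw [P.root_reflectionPerm, P.reflection_apply_self, map_neg] at this
  linarith

lemma IsHighestRoot.isPos (hθ : IsHighestRoot b θ) : b.IsPos θ := by
  by_contra h
  have h' := isPos_reflectionPerm_self.mpr h
  have := hθ.htFun_le (P.reflectionPerm θ θ)
  rw [isPos_iff_htFun] at h h'
  linarith

/-- A functional that is nonnegative on the simple roots is nonnegative on their sums. -/
lemma nonneg_of_mem_closure {f : V →ₗ[ℚ] ℚ} (hf : ∀ i ∈ b.support, 0 ≤ f (P.root i)) {v : V}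
    (hv : v ∈ AddSubmonoid.closure (P.root '' (b.support : Set ι))) : 0 ≤ f v := by
  induction hv using AddSubmonoid.closure_induction with
  | mem x hx =>
    obtain ⟨i, hi, rfl⟩ := hx
    exact hf i hi
  | zero => simp
  | add x y _ _ hx hy => rw [map_add]; exact add_nonneg hx hy

lemma form_root_root_nonneg_iff (i j : ι) :
    0 ≤ B.form (P.root i) (P.root j) ↔ 0 ≤ P.pairingIn ℤ i j := by
  rw [le_iff_lt_or_eq, le_iff_lt_or_eq, form_root_root_pos_iff, eq_comm,
    form_root_root_eq_zero_iff, @eq_comm _ _ (0 : ℤ)]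

lemma root_sub_root_mem_of_form_pos {i j : ι} (h : 0 < B.form (P.root i) (P.root j))
    (hij : i ≠ j) : P.root i - P.root j ∈ Set.range P.root :=
  P.root_sub_root_mem_of_pairingIn_pos ((form_root_root_pos_iff B i j).mp h) hij

lemma IsHighestRoot.form_nonneg (hθ : IsHighestRoot b θ) {i : ι} (hi : b.IsPos i) :
    0 ≤ B.form (P.root θ) (P.root i) := by
  by_contra! h
  rw [isPos_iff_htFun] at hi
  have hneg : P.root (P.reflectionPerm i i) = -P.root i := by
    rw [P.root_reflectionPerm, P.reflection_apply_self]
  have h' : 0 < B.form (P.root θ) (P.root (P.reflectionPerm i i)) := by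
    rw [hneg, map_neg]
    linarith
  have hne : θ ≠ P.reflectionPerm i i := by
    rintro rfl
    have := isPos_iff_htFun.mp hθ.isPos
    rw [hneg, map_neg] at this
    linarith
  obtain ⟨k, hk⟩ := root_sub_root_mem_of_form_pos h' hne
  have := hθ.htFun_le k
  rw [hk, hneg, map_sub, map_neg] at this
  linarith

/-- The affine height: the linear functional on `V̂` with value `1` at the affine simple roots. -/
noncomputable def affHt (b : P.Base) (θ : ι) : AffineSpace V →ₗ[ℚ] ℚ :=
  htFun b ∘ₗ LinearMap.fst ℚ V (ℚ × ℚ) +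
    (htFun b (P.root θ) + 1) • (LinearMap.fst ℚ ℚ ℚ ∘ₗ LinearMap.snd ℚ V (ℚ × ℚ))

@[simp] lemma affHt_emb (v : V) : affHt b θ (emb v) = htFun b v := by
  simp [affHt, emb]

@[simp] lemma affHt_delta : affHt b θ delta = htFun b (P.root θ) + 1 := by
  simp [affHt, delta]

lemma IsHighestRoot.affHt_delta_pos (hθ : IsHighestRoot b θ) : 0 < affHt b θ delta := by
  have := isPos_iff_htFun.mp hθ.isPos
  rw [affHt_delta]
  linarith

lemma affHt_of_mem_simpleRoots {a : AffineSpace V} (ha : a ∈ simpleRoots b θ) :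
    affHt b θ a = 1 := by
  obtain rfl | ⟨i, hi, rfl⟩ := ha
  · simp [alphaZero]
  · simp [htFun_of_mem_support hi]

lemma exists_affHt_eq_intCast {a : AffineSpace V} (ha : a ∈ affRoots P) :
    ∃ n : ℤ, affHt b θ a = n := by
  obtain ⟨i, k, rfl⟩ := ha
  exact ⟨b.height i + k * (b.height θ + 1), by simp [htFun_root]⟩

lemma affHt_add_smul_delta (v : V) (k : ℚ) :
    affHt b θ (emb v + k • delta) = htFun b v + k * (htFun b (P.root θ) + 1) := by
  simp

/-- Finite heights lie between -ht θ and ht θ, while δ has affine height ht θ + 1. So the level,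
when it is nonzero, decides the sign. -/
lemma mem_affinePos_iff (hθ : IsHighestRoot b θ) {a : AffineSpace V} :
    a ∈ affinePos b ↔ a ∈ affRoots P ∧ 0 < affHt b θ a := by
  have hθ0 := isPos_iff_htFun.mp hθ.isPos
  constructor
  · rintro (⟨i, hi, rfl⟩ | ⟨i, k, hk, rfl⟩)
    · exact ⟨emb_root_mem_affRoots i, by simpa using isPos_iff_htFun.mp hi⟩
    · refine ⟨⟨i, k, rfl⟩, ?_⟩
      rw [affHt_add_smul_delta]
      have h1 := hθ.neg_htFun_le i
      have hk' : (1 : ℚ) ≤ k := by exact_mod_cast hk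
      nlinarith
  · rintro ⟨⟨i, k, rfl⟩, h⟩
    rw [affHt_add_smul_delta] at h
    have h1 := hθ.htFun_le i
    obtain hk | rfl | hk := lt_trichotomy k 0
    · have hk' : (k : ℚ) ≤ -1 := by exact_mod_cast Int.le_sub_one_of_lt hk
      nlinarith
    · exact Or.inl ⟨i, isPos_iff_htFun.mpr (by simpa using h), by simp⟩
    · exact Or.inr ⟨i, k, hk, rfl⟩

lemma affHt_ne_zero (hθ : IsHighestRoot b θ) {a : AffineSpace V} (ha : a ∈ affRoots P) :
    affHt b θ a ≠ 0 := by
  have hθ0 := isPos_iff_htFun.mp hθ.isPos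
  obtain ⟨i, k, rfl⟩ := ha
  rw [affHt_add_smul_delta]
  have h1 := hθ.htFun_le i
  have h2 := hθ.neg_htFun_le i
  obtain hk | rfl | hk := lt_trichotomy k 0
  · have hk' : (k : ℚ) ≤ -1 := by exact_mod_cast Int.le_sub_one_of_lt hk
    nlinarith
  · simpa [htFun_root] using b.height_ne_zero i
  · have hk' : (1 : ℚ) ≤ k := by exact_mod_cast hk
    nlinarith

lemma simpleRoots_subset_affinePos (hθ : IsHighestRoot b θ) : simpleRoots b θ ⊆ affinePos b :=
  fun _ ha ↦ (mem_affinePos_iff hθ).mpr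
    ⟨simpleRoots_subset b θ ha, by rw [affHt_of_mem_simpleRoots ha]; exact one_pos⟩

/-- A root has positive inner product with the finite part of some affine simple root. -/
lemma exists_simpleRoot_form_pos (B : P.RootPositiveForm ℚ) (hθ : IsHighestRoot b θ) (i : ι) :
    ∃ (j : ι) (m : ℤ), emb (P.root j) + (m : ℚ) • delta ∈ simpleRoots b θ ∧
      0 < B.form (P.root i) (P.root j) := by
  by_cases h : ∃ j ∈ b.support, 0 < B.form (P.root i) (P.root j)
  · obtain ⟨j, hj, hij⟩ := h
    exact ⟨j, 0, Or.inr ⟨j, hj, by simp⟩, hij⟩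
  push Not at h
  refine ⟨P.reflectionPerm θ θ, 1, Or.inl ?_, ?_⟩
  · simp [alphaZero, emb_neg]
    abel
  -- For γ the root at `i`, θ + γ is a sum of simple roots, so (γ, θ + γ) ≤ 0 and (γ, -θ) ≥ (γ, γ) >
  -- 0.
  · have h1 : 0 ≤ (-(B.form (P.root i))) (P.root θ - P.root (P.reflectionPerm i i)) :=
      nonneg_of_mem_closure (fun j hj ↦ by simpa using h j hj) (hθ _)
    have h2 := form_root_pos B i
    simp only [P.root_reflectionPerm, P.reflection_apply_self, map_sub, map_neg,
      LinearMap.neg_apply] at h1 ⊢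
    linarith

/-- Take a simple c with (a, c) > 0: the difference a - c is a real root, or a multiple of δ when
the finite parts agree. Its height is an integer ≥ 0, and it is not 0, because real roots have
nonzero height and a multiple of δ of height 0 would give a = c. -/
lemma exists_simpleRoot_sub (B : P.RootPositiveForm ℚ) (hθ : IsHighestRoot b θ)
    {a : AffineSpace V} (ha : a ∈ affinePos b)
    (ha' : a ∉ simpleRoots b θ) :
    ∃ c ∈ simpleRoots b θ, 0 < affHt b θ (a - c) ∧
      (a - c ∈ affinePos b ∨ ∃ k : ℤ, a - c = (k : ℚ) • delta) := by
  rw [mem_affinePos_iff hθ] at ha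
  obtain ⟨ha, hpos⟩ := ha
  obtain ⟨n, hn⟩ := exists_affHt_eq_intCast (b := b) (θ := θ) ha
  obtain ⟨i, k, rfl⟩ := ha
  obtain ⟨j, m, hc, hij⟩ := exists_simpleRoot_form_pos B hθ i
  refine ⟨_, hc, ?_⟩
  have hsub : emb (P.root i) + (k : ℚ) • delta - (emb (P.root j) + (m : ℚ) • delta) =
      emb (P.root i - P.root j) + ((k - m : ℤ) : ℚ) • delta := by
    rw [emb_sub]
    push_cast
    module
  have hht : affHt b θ (emb (P.root i) + (k : ℚ) • delta - (emb (P.root j) + (m : ℚ) • delta)) =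
      (n - 1 : ℤ) := by
    rw [map_sub, hn, affHt_of_mem_simpleRoots hc]
    simp
  have hn1 : 0 ≤ n - 1 := by
    rw [hn, Int.cast_pos] at hpos
    omega
  obtain rfl | hne := eq_or_ne i j
  · have h0 : 0 < affHt b θ
        (emb (P.root i) + (k : ℚ) • delta - (emb (P.root i) + (m : ℚ) • delta)) := by
      rw [hht, Int.cast_pos]
      refine lt_of_le_of_ne hn1 fun h ↦ ha' ?_
      rw [← h, hsub] at hht
      have h3 := hθ.affHt_delta_pos
      rw [sub_self, ← zero_smul ℚ (0 : V)] at hht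
      have : ((k - m : ℤ) : ℚ) = 0 := by
        simp only [zero_smul, map_add, affHt_emb, map_zero, map_smul, smul_eq_mul, zero_add,
          Int.cast_zero, mul_eq_zero] at hht
        exact hht.resolve_right h3.ne'
      have hkm : k = m := by
        have : k - m = 0 := by exact_mod_cast this
        omega
      rwa [hkm]
    exact ⟨h0, Or.inr ⟨k - m, by rw [hsub, sub_self]; simp [emb]⟩⟩
  · obtain ⟨l, hl⟩ := root_sub_root_mem_of_form_pos hij hne
    have hmem : emb (P.root i) + (k : ℚ) • delta - (emb (P.root j) + (m : ℚ) • delta) ∈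
        affRoots P := ⟨l, k - m, by rw [hsub, hl]⟩
    have h0 := affHt_ne_zero hθ hmem
    have h1 : 0 < affHt b θ
        (emb (P.root i) + (k : ℚ) • delta - (emb (P.root j) + (m : ℚ) • delta)) :=
      lt_of_le_of_ne (by rw [hht]; exact_mod_cast hn1) h0.symm
    exact ⟨h1, Or.inl ((mem_affinePos_iff hθ).mpr ⟨hmem, h1⟩)⟩

/-- A functional that is positive on the affine simple roots and on `δ` is positive on the positive
affine roots. -/
lemma pos_of_forall_simpleRoots (B : P.RootPositiveForm ℚ) (hθ : IsHighestRoot b θ)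
    (f : AffineSpace V →ₗ[ℚ] ℚ) (hδ : 0 < f delta)
    (hf : ∀ c ∈ simpleRoots b θ, 0 < f c) {a : AffineSpace V} (ha : a ∈ affinePos b) :
    0 < f a := by
  have ha' := (mem_affinePos_iff hθ).mp ha
  obtain ⟨n, hn⟩ := exists_affHt_eq_intCast (b := b) (θ := θ) ha'.1
  have hn0 : 0 ≤ n := by
    have := ha'.2
    rw [hn, Int.cast_pos] at this
    exact this.le
  clear ha'
  lift n to ℕ using hn0
  induction n generalizing a with
  | zero => exact absurd ((mem_affinePos_iff hθ).mp ha).2 (by simp [hn])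
  | succ n ih =>
    by_cases hs : a ∈ simpleRoots b θ
    · exact hf a hs
    obtain ⟨c, hc, hpos, h | ⟨k, hk⟩⟩ := exists_simpleRoot_sub B hθ ha hs
    · have h1 := ih h (by rw [map_sub, hn, affHt_of_mem_simpleRoots hc]; simp)
      have h2 := hf c hc
      rw [map_sub] at h1
      linarith
    · have hk0 : (0 : ℚ) < k := by
        rw [hk, map_smul, smul_eq_mul] at hpos
        exact (pos_iff_pos_of_mul_pos hpos).mpr hθ.affHt_delta_pos
      have h2 := hf c hc
      have h3 : f (a - c) = k * f delta := by rw [hk, map_smul, smul_eq_mul]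
      rw [map_sub] at h3
      nlinarith [mul_pos hk0 hδ]

variable [P.IsReduced]

/-- If ⟨γ, θ^∨⟩ ≥ 2, the bound ht(s_θ γ) ≥ -ht θ gives ht γ ≥ ht θ. Then the root θ - γ would have
height 0. That θ is long is not needed here. -/
lemma IsHighestRoot.pairingIn_le_one (B : P.RootPositiveForm ℚ) (hθ : IsHighestRoot b θ) {i : ι}
    (hi : i ≠ θ) : P.pairingIn ℤ i θ ≤ 1 := by
  by_contra! h
  have hform : 0 < B.form (P.root θ) (P.root i) := by
    rw [form_comm, form_root_root_pos_iff]
    omega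
  obtain ⟨k, hk⟩ := root_sub_root_mem_of_form_pos hform hi.symm
  have h1 : b.height k ≠ 0 := b.height_ne_zero k
  have h2 := hθ.htFun_le i
  have h3 := hθ.neg_htFun_le (P.reflectionPerm θ i)
  have h4 := isPos_iff_htFun.mp hθ.isPos
  rw [P.root_reflectionPerm, P.reflection_apply_root' ℤ, map_sub, map_zsmul, zsmul_eq_mul] at h3
  have h5 : (2 : ℚ) ≤ P.pairingIn ℤ i θ := by exact_mod_cast h
  have h6 : htFun b (P.root k) = 0 := by
    rw [hk, map_sub]
    nlinarith
  rw [htFun_root, Int.cast_eq_zero] at h6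
  exact h1 h6

lemma IsHighestRoot.neg_one_le_pairingIn (B : P.RootPositiveForm ℚ) (hθ : IsHighestRoot b θ)
    {i : ι} (hi : P.root i ≠ -P.root θ) : -1 ≤ P.pairingIn ℤ i θ := by
  have h := hθ.pairingIn_le_one B (i := P.reflectionPerm i i) fun h ↦ hi <| by
    rw [← h, P.root_reflectionPerm, P.reflection_apply_self, neg_neg]
  rw [P.pairingIn_reflectionPerm_self_left] at h
  linarith

/-- An affine simple reflection permutes the other positive affine roots. -/
lemma affRefl_simpleRoot_mem_affinePos (B : P.RootPositiveForm ℚ) (hθ : IsHighestRoot b θ)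
    {a c : AffineSpace V}
    (hc : c ∈ simpleRoots b θ) (ha : a ∈ affinePos b) (hac : a ≠ c) :
    affRefl B c a ∈ affinePos b := by
  have hθ0 := isPos_iff_htFun.mp hθ.isPos
  have ha' := (mem_affinePos_iff hθ).mp ha
  obtain rfl | ⟨i, hi, rfl⟩ := hc
  · rw [mem_affinePos_iff hθ]
    have hmem := affRefl_mem_affRoots B (delta_sub_mem_affRoots θ) ha'.1
    refine ⟨hmem, ?_⟩
    have h0 := affHt_ne_zero hθ hmem
    obtain ⟨n, hn⟩ := exists_affHt_eq_intCast (b := b) (θ := θ) ha'.1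
    obtain ⟨⟨i, k, rfl⟩, hpos⟩ := ha'
    -- The change of height is exactly the pairing, because α₀ has affine height 1.
    have hcalc : affHt b θ (affRefl B (alphaZero P θ) (emb (P.root i) + (k : ℚ) • delta)) =
        affHt b θ (emb (P.root i) + (k : ℚ) • delta) + P.pairingIn ℤ i θ := by
      have h := two_mul_form_root_root B i θ
      have h1 := (form_root_pos B θ).ne'
      rw [affRefl_apply, map_sub (affHt b θ), map_smul,
        affHt_of_mem_simpleRoots (Set.mem_insert _ _), sub_eq_add_neg, add_right_inj]
      simp only [alphaZero, map_sub, map_add, map_smul, LinearMap.sub_apply, affineForm_emb_emb,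
        affineForm_delta_emb, affineForm_emb_delta, affineForm_delta_delta, smul_eq_mul, mul_zero,
        add_zero, sub_zero, zero_sub, neg_neg, mul_one]
      rw [form_comm B (P.root θ) (P.root i)]
      field_simp
      linarith
    change 0 < affHt b θ (affRefl B (alphaZero P θ) _)
    change affHt b θ (affRefl B (alphaZero P θ) _) ≠ 0 at h0
    rw [hcalc] at h0 ⊢
    by_cases hiθ : P.root i = -P.root θ
    · have hp : P.pairingIn ℤ i θ = -2 := by
        have : i = P.reflectionPerm θ θ := P.root.injective <| by
          rw [hiθ, P.root_reflectionPerm, P.reflection_apply_self]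
        rw [this, P.pairingIn_reflectionPerm_self_left, P.pairingIn_same]
      rw [hp, affHt_add_smul_delta, hiθ, map_neg]
      rw [affHt_add_smul_delta, hiθ, map_neg] at hpos
      obtain hk | hk | hk : k ≤ 0 ∨ k = 1 ∨ 2 ≤ k := by omega
      · have : (k : ℚ) ≤ 0 := by exact_mod_cast hk
        nlinarith
      · refine absurd ?_ hac
        rw [hiθ, hk, alphaZero, emb_neg]
        simp
        abel
      · have : (2 : ℚ) ≤ k := by exact_mod_cast hk
        push_cast
        nlinarith
    -- An integer height ≥ 1 drops by at most 1, and the result is not 0.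
    · have hp := hθ.neg_one_le_pairingIn B hiθ
      rw [hn] at h0 hpos ⊢
      norm_cast at h0 hpos ⊢
      omega
  · obtain ⟨j, hj, rfl⟩ | ⟨j, k, hk, rfl⟩ := ha
    · have h := affRefl_affRoot_apply B i j 0 0
      simp only [Int.cast_zero, zero_smul, add_zero, mul_zero, sub_zero] at h
      refine Or.inl ⟨P.reflectionPerm i j, hj.reflectionPerm hi ?_, h⟩
      rintro rfl
      exact hac rfl
    · have h := affRefl_affRoot_apply B i j 0 k
      simp only [Int.cast_zero, zero_smul, add_zero, mul_zero, sub_zero] at h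
      exact Or.inr ⟨_, k, hk, h⟩

end Positivity

/-! ### Inversion sets and the exchange condition. -/

section Inversions

variable {ι V N : Type*} [Finite ι] [AddCommGroup V] [Module ℚ V] [AddCommGroup N] [Module ℚ N]
  {P : RootPairing ι ℚ V N} [P.IsRootSystem] [P.IsCrystallographic] [P.IsReduced]
  {B : P.RootPositiveForm ℚ} {b : P.Base} {θ : ι} {w : AffineSpace V ≃ₗ[ℚ] AffineSpace V}

lemma mem_affinePos_or_neg_mem (hθ : IsHighestRoot b θ) {a : AffineSpace V} (ha : a ∈ affRoots P) :
    a ∈ affinePos b ∨ -a ∈ affinePos b := by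
  rw [mem_affinePos_iff hθ, mem_affinePos_iff hθ, map_neg]
  obtain h | h := (affHt_ne_zero hθ ha).lt_or_gt
  · exact Or.inr ⟨neg_mem_affRoots ha, by linarith⟩
  · exact Or.inl ⟨ha, h⟩

lemma neg_notMem_affinePos (hθ : IsHighestRoot b θ) {a : AffineSpace V} (ha : a ∈ affinePos b) :
    -a ∉ affinePos b := by
  rw [mem_affinePos_iff hθ] at ha ⊢
  rw [map_neg]
  rintro ⟨-, h⟩
  linarith [ha.2]

lemma mem_inversionSet_iff (hθ : IsHighestRoot b θ) (hw : w ∈ affAut B) {a : AffineSpace V} :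
    a ∈ inversionSet b w ↔ a ∈ affinePos b ∧ affHt b θ (w a) < 0 := by
  rw [inversionSet, Set.mem_ofPred_eq, mem_affinePos_iff hθ (a := -(w a)), map_neg]
  refine and_congr_right fun ha ↦ ⟨fun h ↦ by linarith [h.2], fun h ↦ ⟨?_, by linarith⟩⟩
  exact neg_mem_affRoots ((map_mem_affRoots hw).mpr ((mem_affinePos_iff hθ).mp ha).1)

lemma map_mem_affinePos (hθ : IsHighestRoot b θ) (hw : w ∈ affAut B) {a : AffineSpace V}
    (ha : a ∈ affinePos b) (ha' : a ∉ inversionSet b w) : w a ∈ affinePos b :=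
  (mem_affinePos_or_neg_mem hθ
    ((map_mem_affRoots hw).mpr ((mem_affinePos_iff hθ).mp ha).1)).resolve_right fun h ↦ ha' ⟨ha, h⟩

/-- The exchange condition for words in the affine simple reflections. -/
lemma exists_word_mul_affRefl (hθ : IsHighestRoot b θ)
    (l : List (AffineSpace V ≃ₗ[ℚ] AffineSpace V)) (hl : ∀ g ∈ l, g ∈ affRefl B '' simpleRoots b θ)
    {c : AffineSpace V} (hc : c ∈ simpleRoots b θ) (hneg : -(l.prod c) ∈ affinePos b) :
    ∃ l' : List (AffineSpace V ≃ₗ[ℚ] AffineSpace V), l'.length + 1 = l.length ∧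
      (∀ g ∈ l', g ∈ affRefl B '' simpleRoots b θ) ∧ l'.prod = l.prod * affRefl B c := by
  induction l with
  | nil => exact absurd hneg (neg_notMem_affinePos hθ (simpleRoots_subset_affinePos hθ hc))
  | cons g t ih =>
    obtain ⟨d, hd, rfl⟩ := hl g (by simp)
    have ht : ∀ g ∈ t, g ∈ affRefl B '' simpleRoots b θ := fun g hg ↦ hl g (by simp [hg])
    have htw : t.prod ∈ affAut B := by
      refine (affAut B).list_prod_mem fun g hg ↦ ?_
      obtain ⟨e, he, rfl⟩ := ht g hg
      exact affRefl_mem_affAut B (simpleRoots_subset b θ he)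
    obtain h | h := mem_affinePos_or_neg_mem hθ
      ((map_mem_affRoots htw).mpr (simpleRoots_subset b θ hc))
    -- The reflection in d makes only d negative. Once t.prod c = d, conjugation moves it past t,
    -- where it becomes the reflection in c and the first letter can be dropped.
    · have heq : t.prod c = d := by
        by_contra hne
        refine neg_notMem_affinePos hθ (affRefl_simpleRoot_mem_affinePos B hθ hd h hne) ?_
        simpa using hneg
      refine ⟨t, rfl, ht, ?_⟩
      rw [List.prod_cons, mul_assoc, ← affRefl_map htw, heq, ← mul_assoc, affRefl_mul_self, one_mul]
    · obtain ⟨l', h1, h2, h3⟩ := ih ht h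
      exact ⟨affRefl B d :: l', by simp [h1], List.forall_mem_cons.mpr ⟨⟨d, hd, rfl⟩, h2⟩,
        by rw [List.prod_cons, List.prod_cons, h3, mul_assoc]⟩

lemma exists_word (hw : w ∈ affineWeyl B b θ) :
    ∃ l : List (AffineSpace V ≃ₗ[ℚ] AffineSpace V),
      (∀ g ∈ l, g ∈ affRefl B '' simpleRoots b θ) ∧ l.prod = w := by
  rw [affineWeyl_eq] at hw
  induction hw using Subgroup.closure_induction with
  | mem x hx => exact ⟨[x], by simpa using hx, by simp⟩
  | one => exact ⟨[], by simp, rfl⟩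
  | mul x y _ _ hx hy =>
    obtain ⟨l, hl, rfl⟩ := hx
    obtain ⟨m, hm, rfl⟩ := hy
    exact ⟨l ++ m, fun g hg ↦ (List.mem_append.mp hg).elim (hl g) (hm g), by simp⟩
  | inv x _ hx =>
    obtain ⟨l, hl, rfl⟩ := hx
    refine ⟨(l.map (·⁻¹)).reverse, fun g hg ↦ ?_, (List.prod_inv_reverse l).symm⟩
    obtain ⟨s, hs, rfl⟩ := List.mem_map.mp (List.mem_reverse.mp hg)
    obtain ⟨c, hc, rfl⟩ := hl s hs
    exact ⟨c, hc, eq_inv_of_mul_eq_one_left (affRefl_mul_self B c)⟩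

/-- The only element of the affine Weyl group without inversions is the identity. -/
lemma eq_one_of_inversionSet_eq_empty (hθ : IsHighestRoot b θ) (hw : w ∈ affineWeyl B b θ)
    (h : inversionSet b w = ∅) : w = 1 := by
  classical
  have hex : ∃ n, ∃ l : List (AffineSpace V ≃ₗ[ℚ] AffineSpace V), l.length = n ∧
      (∀ g ∈ l, g ∈ affRefl B '' simpleRoots b θ) ∧ l.prod = w := by
    obtain ⟨l, hl⟩ := exists_word hw
    exact ⟨_, l, rfl, hl⟩
  -- In a shortest word that is nonempty, the last letter could be exchanged away, giving a shorter
  -- word for w.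
  obtain ⟨l, hlen, hl, hlw⟩ := Nat.find_spec hex
  induction l using List.reverseRecOn with
  | nil => simpa using hlw.symm
  | append_singleton t g _ =>
    exfalso
    obtain ⟨c, hc, rfl⟩ := hl g (by simp)
    have hneg : -(t.prod c) ∈ affinePos b := by
      have h1 : w c ∈ affinePos b := by
        refine map_mem_affinePos hθ (affineWeyl_le_affAut B b θ hw)
          (simpleRoots_subset_affinePos hθ hc) ?_
        rw [h]
        exact Set.notMem_empty _
      rw [← hlw] at h1
      simpa [affRefl_apply_self B (affineForm_self_ne_zero B (simpleRoots_subset b θ hc))] using h1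
    obtain ⟨l', h1, h2, h3⟩ := exists_word_mul_affRefl hθ t (fun g hg ↦ hl g (by simp [hg])) hc hneg
    refine Nat.find_min hex (m := l'.length) ?_ ⟨l', rfl, h2, ?_⟩
    · rw [← hlen, List.length_append]
      simp
      omega
    · rw [h3, ← hlw]
      simp

/-- Elements of the affine Weyl group are determined by their inversions. -/
lemma inversionSet_injOn (hθ : IsHighestRoot b θ) :
    Set.InjOn (inversionSet b) (affineWeyl B b θ : Set (AffineSpace V ≃ₗ[ℚ] AffineSpace V)) := by
  intro u hu v hv h
  have hu' := affineWeyl_le_affAut B b θ hu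
  have hv' := affineWeyl_le_affAut B b θ hv
  -- If a were an inversion of v u⁻¹, then u⁻¹ a, up to sign, would be an inversion of exactly one
  -- of u and v.
  suffices inversionSet b (v * u⁻¹) = ∅ from
    (mul_inv_eq_one.mp (eq_one_of_inversionSet_eq_empty hθ (mul_mem hv (inv_mem hu)) this)).symm
  rw [Set.eq_empty_iff_forall_notMem]
  rintro a ⟨ha, hneg⟩
  have hu1 := inv_mem hu'
  have haR := ((mem_affinePos_iff hθ).mp ha).1
  obtain h1 | h1 := mem_affinePos_or_neg_mem hθ ((map_mem_affRoots hu1).mpr haR)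
  · have h2 : u⁻¹ a ∈ inversionSet b u := by
      rw [h]
      exact ⟨h1, hneg⟩
    refine neg_notMem_affinePos hθ ha ?_
    simpa using h2.2
  · have h2 : -(u⁻¹ a) ∈ inversionSet b v := by
      rw [← h]
      exact ⟨h1, by simpa using ha⟩
    refine neg_notMem_affinePos hθ hneg ?_
    simpa using h2.2

/-- If `w` has an inversion, then it has an affine simple root as inversion. -/
lemma exists_simpleRoot_mem_inversionSet (hθ : IsHighestRoot b θ) (hw : w ∈ affAut B)
    (h : (inversionSet b w).Nonempty) : ∃ c ∈ simpleRoots b θ, c ∈ inversionSet b w := by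
  by_contra! hc
  obtain ⟨a, ha⟩ := h
  rw [mem_inversionSet_iff hθ hw] at ha
  refine lt_asymm ha.2 (pos_of_forall_simpleRoots B hθ (affHt b θ ∘ₗ w.toLinearMap) ?_ ?_ ha.1)
  · simpa [map_delta hw] using hθ.affHt_delta_pos
  · intro c hcs
    have h1 := map_mem_affinePos hθ hw (simpleRoots_subset_affinePos hθ hcs) (hc c hcs)
    exact ((mem_affinePos_iff hθ).mp h1).2

/-- The reflection in the simple root w a changes the sign of ±w a only. -/
lemma inversionSet_affRefl_mul (hθ : IsHighestRoot b θ) (hw : w ∈ affAut B) {a : AffineSpace V}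
    (ha : a ∈ affinePos b) (hwa : w a ∈ simpleRoots b θ) :
    inversionSet b (affRefl B (w a) * w) = insert a (inversionSet b w) := by
  have hself := affRefl_apply_self B (affineForm_self_ne_zero B (simpleRoots_subset b θ hwa))
  have hpos := simpleRoots_subset_affinePos hθ hwa
  ext x
  rw [Set.mem_insert_iff]
  constructor
  · rintro ⟨hx, hneg⟩
    rw [or_iff_not_imp_left]
    intro hxa
    by_contra hx'
    refine neg_notMem_affinePos hθ ?_ hneg
    exact affRefl_simpleRoot_mem_affinePos B hθ hwa (map_mem_affinePos hθ hw hx hx')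
      fun h ↦ hxa (w.injective h)
  · rintro (rfl | ⟨hx, hneg⟩)
    · exact ⟨ha, by simpa [hself] using hpos⟩
    · refine ⟨hx, ?_⟩
      have := affRefl_simpleRoot_mem_affinePos B hθ hwa hneg fun h ↦ by
        have hxa : x = -a := w.injective (by rw [map_neg, ← h, neg_neg])
        rw [hxa] at hx
        exact neg_notMem_affinePos hθ ha hx
      simpa using this

lemma inversionSet_mul_affRefl (hθ : IsHighestRoot b θ) {c : AffineSpace V}
    (hc : c ∈ simpleRoots b θ) (hwc : c ∈ inversionSet b w) :
    inversionSet b (w * affRefl B c) = affRefl B c '' (inversionSet b w \ {c}) := by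
  have hself := affRefl_apply_self B (affineForm_self_ne_zero B (simpleRoots_subset b θ hc))
  ext x
  constructor
  · rintro ⟨hx, hneg⟩
    refine ⟨affRefl B c x, ⟨⟨affRefl_simpleRoot_mem_affinePos B hθ hc hx ?_, hneg⟩, ?_⟩,
      affRefl_affRefl B c x⟩
    · rintro rfl
      refine neg_notMem_affinePos hθ hwc.2 ?_
      simpa [hself] using hneg
    · intro h
      rw [Set.mem_singleton_iff] at h
      have : x = -c := (affRefl B c).injective (by rw [h, map_neg, hself, neg_neg])
      rw [this] at hx
      exact neg_notMem_affinePos hθ hwc.1 hx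
  · rintro ⟨y, ⟨⟨hy, hneg⟩, hyc⟩, rfl⟩
    exact ⟨affRefl_simpleRoot_mem_affinePos B hθ hc hy hyc, by
      simpa [affRefl_affRefl] using hneg⟩

end Inversions

/-! ### Minuscule elements and Abelian ideals. -/

section Minuscule

variable {ι V N : Type*} [Finite ι] [AddCommGroup V] [Module ℚ V] [AddCommGroup N] [Module ℚ N]
  {P : RootPairing ι ℚ V N} [P.IsRootSystem] [P.IsCrystallographic] [P.IsReduced]
  {B : P.RootPositiveForm ℚ} {b : P.Base} {θ : ι} {w : AffineSpace V ≃ₗ[ℚ] AffineSpace V}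

lemma IsMinuscule.mem_affAut (hw : IsMinuscule B b θ w) : w ∈ affAut B :=
  affineWeyl_le_affAut B b θ hw.1

lemma delta_sub_emb_root_injective : Function.Injective fun γ ↦ delta - emb (P.root γ) :=
  fun _ _ h ↦ P.root.injective (emb_injective (sub_right_injective h))

lemma delta_sub_mem_affinePos (γ : ι) : delta - emb (P.root γ) ∈ affinePos b :=
  Or.inr ⟨P.reflectionPerm γ γ, 1, le_rfl, by simp [emb_neg]; abel⟩

lemma mem_idealOf_iff (hθ : IsHighestRoot b θ) (hw : w ∈ affAut B) {γ : ι} :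
    γ ∈ idealOf b w ↔ b.IsPos γ ∧ affHt b θ (w (delta - emb (P.root γ))) < 0 := by
  rw [idealOf, Set.mem_ofPred_eq, mem_inversionSet_iff hθ hw,
    and_iff_right (delta_sub_mem_affinePos γ)]

lemma idealOf_eq_of_inversionSet_eq {I : Set ι} (hI : ∀ γ ∈ I, b.IsPos γ)
    (h : inversionSet b w = (fun γ ↦ delta - emb (P.root γ)) '' I) : idealOf b w = I := by
  ext γ
  rw [idealOf, Set.mem_ofPred_eq, h, delta_sub_emb_root_injective.mem_set_image]
  exact ⟨fun h ↦ h.2, fun h ↦ ⟨hI γ h, h⟩⟩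

lemma IsMinuscule.inversionSet_eq (hw : IsMinuscule B b θ w) :
    inversionSet b w = (fun γ ↦ delta - emb (P.root γ)) '' idealOf b w := by
  obtain ⟨I, hI, h⟩ := hw.2
  rw [idealOf_eq_of_inversionSet_eq hI h, h]

lemma IsMinuscule.eq_of_idealOf_eq (hθ : IsHighestRoot b θ)
    {v : AffineSpace V ≃ₗ[ℚ] AffineSpace V} (hv : IsMinuscule B b θ v)
    (hw : IsMinuscule B b θ w) (h : idealOf b v = idealOf b w) : v = w :=
  inversionSet_injOn hθ hv.1 hw.1 (by rw [hv.inversionSet_eq, hw.inversionSet_eq, h])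

lemma isMinuscule_one (hθ : IsHighestRoot b θ) : IsMinuscule B b θ 1 := by
  refine ⟨one_mem _, ∅, by simp, ?_⟩
  rw [Set.image_empty, Set.eq_empty_iff_forall_notMem]
  exact fun a ha ↦ neg_notMem_affinePos hθ ha.1 ha.2

lemma idealOf_one (hθ : IsHighestRoot b θ) : idealOf b (1 : AffineSpace V ≃ₗ[ℚ] AffineSpace V) = ∅ :=
  Set.eq_empty_iff_forall_notMem.mpr fun _ h ↦ neg_notMem_affinePos hθ h.2.1 h.2.2

lemma IsMinuscule.idealOf_nonempty (hθ : IsHighestRoot b θ) (hw : IsMinuscule B b θ w)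
    (h1 : w ≠ 1) : (idealOf b w).Nonempty := by
  rw [Set.nonempty_iff_ne_empty]
  intro h
  exact h1 (hw.eq_of_idealOf_eq hθ (isMinuscule_one hθ) (by rw [h, idealOf_one hθ]))

/-- Inversions live at level 1. If μ + ν were a root, 2δ - μ - ν would be an inversion at level 2.
As ν at level 0 stays positive, (δ - γ) - ν is sent to a negative root minus a positive one. -/
lemma IsMinuscule.isAbelianIdeal (hθ : IsHighestRoot b θ) (hw : IsMinuscule B b θ w) :
    IsAbelianIdeal b (idealOf b w) where
  pos γ hγ := hγ.1
  abelian := by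
    rintro μ hμ ν hν ⟨κ, hκ⟩
    rw [mem_idealOf_iff hθ hw.mem_affAut] at hμ hν
    have heq : delta - emb (P.root μ) + (delta - emb (P.root ν)) =
        emb (P.root (P.reflectionPerm κ κ)) + ((2 : ℤ) : ℚ) • delta := by
      rw [P.root_reflectionPerm, P.reflection_apply_self, hκ, emb_neg, emb_add]
      push_cast
      module
    have hmem : delta - emb (P.root μ) + (delta - emb (P.root ν)) ∈ inversionSet b w := by
      rw [mem_inversionSet_iff hθ hw.mem_affAut, map_add, map_add]
      exact ⟨Or.inr ⟨_, 2, by norm_num, heq⟩, by linarith [hμ.2, hν.2]⟩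
    rw [hw.inversionSet_eq] at hmem
    obtain ⟨γ, -, hγ⟩ := hmem
    have := congrArg (·.2.1) hγ
    norm_num at this
  ideal := by
    intro γ hγ ν hν κ hκ
    have hγ' := (mem_idealOf_iff hθ hw.mem_affAut).mp hγ
    rw [mem_idealOf_iff hθ hw.mem_affAut]
    refine ⟨hγ'.1.add hν hκ, ?_⟩
    have hνpos : w (emb (P.root ν)) ∈ affinePos b := by
      refine map_mem_affinePos hθ hw.mem_affAut (Or.inl ⟨ν, hν, rfl⟩) fun h ↦ ?_
      rw [hw.inversionSet_eq] at h
      obtain ⟨γ, -, hγ⟩ := h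
      have := congrArg (·.2.1) hγ
      norm_num at this
    have h1 := ((mem_affinePos_iff hθ).mp hνpos).2
    have h2 : delta - emb (P.root κ) = delta - emb (P.root γ) - emb (P.root ν) := by
      rw [hκ, emb_add]
      abel
    rw [h2, map_sub, map_sub]
    linarith [hγ'.2]

/-- Removing an element that is not a sum of an element of the ideal and a positive root. -/
lemma IsAbelianIdeal.diff_singleton {I : Set ι} (hI : IsAbelianIdeal b I) {γ : ι}
    (hγ : ∀ μ ∈ I, ∀ ν, b.IsPos ν → P.root γ ≠ P.root μ + P.root ν) :
    IsAbelianIdeal b (I \ {γ}) where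
  pos μ hμ := hI.pos μ hμ.1
  abelian μ hμ ν hν := hI.abelian μ hμ.1 ν hν.1
  ideal μ hμ ν hν κ hκ :=
    ⟨hI.ideal μ hμ.1 ν hν κ hκ, by rintro rfl; exact hγ μ hμ.1 ν hν hκ⟩

/-- Otherwise w(δ - γ) splits off a simple root. Pulling the two summands back by w writes δ - γ as
x + y with w x and w y both positive, and the ideal and Abelian properties of I exclude every such
splitting. -/
lemma map_delta_sub_mem_simpleRoots (hθ : IsHighestRoot b θ) {I : Set ι}
    (hI : IsAbelianIdeal b I) {γ : ι} (hγ : γ ∈ I) (hw : IsMinuscule B b θ w)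
    (hwI : idealOf b w = I \ {γ}) : w (delta - emb (P.root γ)) ∈ simpleRoots b θ := by
  have hwA := hw.mem_affAut
  have hmem {μ : ι} : delta - emb (P.root μ) ∈ inversionSet b w ↔ μ ∈ I \ {γ} := by
    rw [hw.inversionSet_eq, delta_sub_emb_root_injective.mem_set_image, hwI]
  have hcases {x : AffineSpace V} (hx : x ∈ affRoots P) (hwx : w x ∈ affinePos b) :
      x ∈ affinePos b ∨ ∃ μ ∈ I, x = emb (P.root μ) - delta := by
    refine (mem_affinePos_or_neg_mem hθ hx).imp_right fun h ↦ ?_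
    have h' : -x ∈ inversionSet b w := ⟨h, by simpa using hwx⟩
    rw [hw.inversionSet_eq, hwI] at h'
    obtain ⟨μ, hμ, hμx⟩ := h'
    exact ⟨μ, hμ.1, by rw [← neg_neg x, ← hμx, neg_sub]⟩
  -- A summand ν ∈ Δ⁺ makes the other one δ - (γ + ν). It is an inversion of w, since γ + ν lies in
  -- I and differs from γ.
  have hfin {ν i : ι} {k : ℤ} (hν : b.IsPos ν)
      (hw' : w (emb (P.root i) + (k : ℚ) • delta) ∈ affinePos b)
      (h : emb (P.root ν) + (emb (P.root i) + (k : ℚ) • delta) = delta - emb (P.root γ)) :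
      False := by
    have h1 : P.root ν + P.root i = - P.root γ := by simpa using congrArg (·.1) h
    have h2 : (k : ℚ) = 1 := by simpa using congrArg (·.2.1) h
    have hκ : P.root (P.reflectionPerm i i) = P.root γ + P.root ν := by
      rw [P.root_reflectionPerm, P.reflection_apply_self, ← neg_eq_iff_eq_neg.mpr h1]
      abel
    have hκI : P.reflectionPerm i i ∈ I \ {γ} := by
      refine ⟨hI.ideal γ hγ ν hν _ hκ, fun h ↦ P.ne_zero ν ?_⟩
      rw [Set.mem_singleton_iff.mp h] at hκ
      simpa using hκ
    rw [← hmem] at hκI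
    refine neg_notMem_affinePos hθ hw' ?_
    have := hκI.2
    rw [P.root_reflectionPerm, P.reflection_apply_self, emb_neg, sub_neg_eq_add] at this
    rwa [h2, one_smul, add_comm (emb _)]
  -- A summand μ - δ makes the other one 2δ - (γ + μ), so γ + μ would be a root.
  have hab {x : AffineSpace V} {μ : ι} (hx : x ∈ affRoots P) (hμ : μ ∈ I)
      (h : x + (emb (P.root μ) - delta) = delta - emb (P.root γ)) : False := by
    obtain ⟨i, k, rfl⟩ := hx
    have h1 : P.root i + P.root μ = - P.root γ := by simpa using congrArg (·.1) h
    refine hI.abelian γ hγ μ hμ ⟨P.reflectionPerm i i, ?_⟩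
    rw [P.root_reflectionPerm, P.reflection_apply_self, ← neg_eq_iff_eq_neg.mpr h1]
    abel
  have hwpos : w (delta - emb (P.root γ)) ∈ affinePos b :=
    map_mem_affinePos hθ hwA (delta_sub_mem_affinePos γ) fun h ↦ (hmem.mp h).2 rfl
  by_contra hns
  obtain ⟨c, hc, hpos, hsub⟩ := exists_simpleRoot_sub B hθ hwpos hns
  have hcpos := simpleRoots_subset_affinePos hθ hc
  obtain ⟨y, rfl⟩ := w.surjective c
  have hyR := (map_mem_affRoots hwA).mp (simpleRoots_subset b θ hc)
  rw [← map_sub] at hpos hsub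
  obtain ⟨x, hx⟩ : ∃ x, x = delta - emb (P.root γ) - y := ⟨_, rfl⟩
  have hxy : x + y = delta - emb (P.root γ) := by rw [hx]; abel
  rw [← hx] at hpos hsub
  obtain hxpos | ⟨k, hk⟩ := hsub
  · have hxR := (map_mem_affRoots hwA).mp ((mem_affinePos_iff hθ).mp hxpos).1
    obtain hx1 | ⟨μ, hμ, rfl⟩ := hcases hxR hxpos
    · obtain hy1 | ⟨μ, hμ, rfl⟩ := hcases hyR hcpos
      · obtain ⟨i, hi, rfl⟩ | ⟨i, k, hk, rfl⟩ := hx1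
        · obtain ⟨j, hj, rfl⟩ | ⟨j, m, hm, rfl⟩ := hy1
          · have := congrArg (·.2.1) hxy
            norm_num at this
          · exact hfin hi hcpos hxy
        · obtain ⟨j, hj, rfl⟩ | ⟨j, m, hm, rfl⟩ := hy1
          · exact hfin hj hxpos (by rw [← hxy]; abel)
          · have h1 : (k : ℚ) + m = 1 := by simpa using congrArg (·.2.1) hxy
            norm_cast at h1
            omega
      · exact hab hxR hμ hxy
    · exact hab hyR hμ (by rw [← hxy]; abel)
  -- Imaginary summand: k ≥ 1, so y has finite part -γ and level 1 - k ≤ 0. It is neither positive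
  -- nor of the form μ - δ with μ positive.
  · have hxk : x = (k : ℚ) • delta := w.injective (by rw [hk, map_smul, map_delta hwA])
    have hk0 : (0 : ℚ) < k := by
      rw [hk, map_smul, smul_eq_mul] at hpos
      exact (pos_iff_pos_of_mul_pos hpos).mpr hθ.affHt_delta_pos
    have hk1 : (1 : ℚ) ≤ k := by
      norm_cast at hk0 ⊢
    obtain hy1 | ⟨μ, hμ, rfl⟩ := hcases hyR hcpos
    · have h1 := ((mem_affinePos_iff hθ).mp hy1).2
      have h2 : affHt b θ x + affHt b θ y = affHt b θ delta - htFun b (P.root γ) := by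
        rw [← map_add, hxy, map_sub, affHt_emb]
      have h3 := isPos_iff_htFun.mp (hI.pos γ hγ)
      rw [hxk, map_smul, smul_eq_mul] at h2
      nlinarith [hθ.affHt_delta_pos]
    · have h1 : P.root μ = - P.root γ := by
        rw [hxk] at hxy
        simpa using congrArg (·.1) hxy
      have h2 := isPos_iff_htFun.mp (hI.pos γ hγ)
      have h3 := isPos_iff_htFun.mp (hI.pos μ hμ)
      rw [h1, map_neg] at h3
      linarith

/-- Adding a root to the ideal of a minuscule element. -/
lemma IsMinuscule.affRefl_mul (hθ : IsHighestRoot b θ) {I : Set ι}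
    (hI : IsAbelianIdeal b I) {γ : ι} (hγ : γ ∈ I) (hw : IsMinuscule B b θ w)
    (hwI : idealOf b w = I \ {γ}) :
    IsMinuscule B b θ (affRefl B (w (delta - emb (P.root γ))) * w) ∧
      idealOf b (affRefl B (w (delta - emb (P.root γ))) * w) = I := by
  have hs := map_delta_sub_mem_simpleRoots hθ hI hγ hw hwI
  have hN : inversionSet b (affRefl B (w (delta - emb (P.root γ))) * w) =
      (fun γ ↦ delta - emb (P.root γ)) '' I := by
    rw [inversionSet_affRefl_mul hθ hw.mem_affAut (delta_sub_mem_affinePos γ) hs,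
      hw.inversionSet_eq, hwI]
    conv_rhs => rw [← Set.insert_eq_of_mem hγ, ← Set.insert_sdiff_singleton, Set.image_insert_eq]
  exact ⟨⟨mul_mem (affRefl_mem_affineWeyl B hs) hw.1, I, hI.pos, hN⟩,
    idealOf_eq_of_inversionSet_eq hI.pos hN⟩

/-- Every Abelian ideal comes from a minuscule element. -/
lemma IsAbelianIdeal.exists_isMinuscule (B : P.RootPositiveForm ℚ) (hθ : IsHighestRoot b θ)
    {I : Set ι} (hI : IsAbelianIdeal b I) :
    ∃ w, IsMinuscule B b θ w ∧ idealOf b w = I := by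
  obtain ⟨n, hn⟩ : ∃ n, I.ncard = n := ⟨_, rfl⟩
  induction n generalizing I with
  | zero =>
    rw [Set.ncard_eq_zero] at hn
    exact ⟨1, isMinuscule_one hθ, by rw [idealOf_one hθ, hn]⟩
  | succ n ih =>
    -- A member of least height is not the sum of a member and a positive root, so removing it
    -- leaves an Abelian ideal.
    obtain ⟨γ, hγ, hmin⟩ := I.toFinite.exists_minimalFor (fun i ↦ htFun b (P.root i)) I
      (Set.nonempty_of_ncard_ne_zero (by omega))
    have hI' := hI.diff_singleton (γ := γ) fun μ hμ ν hν h ↦ by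
      have h1 := isPos_iff_htFun.mp hν
      have h2 := hmin hμ (by simp only [h, map_add]; linarith)
      simp only [h, map_add] at h2
      linarith
    obtain ⟨w, hw, hwI⟩ := ih hI' (by rw [Set.ncard_sdiff_singleton_of_mem hγ, hn]; rfl)
    exact ⟨_, hw.affRefl_mul hθ hI hγ hwI⟩

/-- The map `w ↦ I_w` is a bijection from the nontrivial minuscule elements onto the nontrivial
Abelian ideals. -/
lemma bijOn_idealOf (B : P.RootPositiveForm ℚ) (hθ : IsHighestRoot b θ) :
    Set.BijOn (idealOf b) {w | IsMinuscule B b θ w ∧ w ≠ 1} (nontrivialIdeals b) := by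
  refine ⟨fun w hw ↦ ⟨hw.1.isAbelianIdeal hθ, hw.1.idealOf_nonempty hθ hw.2⟩,
    fun v hv w hw h ↦ hv.1.eq_of_idealOf_eq hθ hw.1 h, fun I hI ↦ ?_⟩
  obtain ⟨w, hw, rfl⟩ := hI.1.exists_isMinuscule B hθ
  refine ⟨w, ⟨hw, ?_⟩, rfl⟩
  rintro rfl
  exact hI.2.ne_empty (idealOf_one hθ)

lemma mem_heisenbergRoots_of_add {μ ν κ : ι} (hθ : IsHighestRoot b θ)
    (hμ : μ ∈ heisenbergRoots B b θ) (hν : b.IsPos ν) (hκ : P.root κ = P.root μ + P.root ν) :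
    κ ∈ heisenbergRoots B b θ := by
  refine ⟨hμ.1.add hν hκ, ?_⟩
  rw [hκ, map_add]
  linarith [hμ.2, hθ.form_nonneg (B := B) hν]

/-- The intersection of an Abelian ideal with the Heisenberg root set lies in the same fibre of the
rootlet map. -/
lemma IsMinuscule.exists_inter_heisenbergRoots (hθ : IsHighestRoot b θ)
    (hw : IsMinuscule B b θ w) :
    ∃ v, IsMinuscule B b θ v ∧ idealOf b v = idealOf b w ∩ heisenbergRoots B b θ ∧
      v (alphaZero P θ) = w (alphaZero P θ) := by
  obtain ⟨n, hn⟩ : ∃ n, (idealOf b w).ncard = n := ⟨_, rfl⟩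
  induction n using Nat.strong_induction_on generalizing w with
  | _ n ih =>
  by_cases hsub : idealOf b w ⊆ heisenbergRoots B b θ
  · exact ⟨w, hw, (Set.inter_eq_left.mpr hsub).symm, rfl⟩
  obtain ⟨γ, hγ, hmin⟩ := (Set.toFinite (idealOf b w \ heisenbergRoots B b θ)).exists_minimalFor
    (fun i ↦ htFun b (P.root i)) _ (Set.sdiff_nonempty.mpr hsub)
  have hI := hw.isAbelianIdeal hθ
  have hI' := hI.diff_singleton (γ := γ) fun μ hμ ν hν h ↦ by
    -- The Heisenberg set is closed under adding positive roots. Hence a summand μ in the ideal lies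
    -- outside it too, against minimality of height there.
    have h1 := isPos_iff_htFun.mp hν
    have h3 : μ ∉ heisenbergRoots B b θ := fun hμ' ↦
      hγ.2 (mem_heisenbergRoots_of_add hθ hμ' hν h)
    have h2 := hmin ⟨hμ, h3⟩ (by simp only [h, map_add]; linarith)
    simp only [h, map_add] at h2
    linarith
  obtain ⟨u, hu, huI⟩ := hI'.exists_isMinuscule B hθ
  obtain ⟨h1, h2⟩ := hu.affRefl_mul hθ hI hγ.1 huI
  have hwu := h1.eq_of_idealOf_eq hθ hw h2
  obtain ⟨v, hv, hvI, hv0⟩ := ih (idealOf b u).ncard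
    (by rw [huI, ← hn]; exact Set.ncard_sdiff_singleton_lt_of_mem hγ.1) hu rfl
  refine ⟨v, hv, ?_, ?_⟩
  · rw [hvI, huI, ← Set.inter_sdiff_right_comm, Set.sdiff_singleton_eq_self fun h ↦ hγ.2 h.2]
  · rw [hv0, ← hwu, LinearEquiv.mul_apply, affRefl_apply_of_orthogonal]
    rw [affineForm_map hu.mem_affAut]
    -- (δ - γ, δ - θ) = (γ, θ) = 0, so the reflection that adds γ back fixes the image of α₀.
    have h3 : B.form (P.root γ) (P.root θ) = 0 := by
      rw [form_comm]
      refine le_antisymm (not_lt.mp fun h ↦ hγ.2 ⟨hγ.1.1, h⟩) (hθ.form_nonneg hγ.1.1)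
    simp [alphaZero, h3]

end Minuscule

/-! ### Levels, the finite Weyl group, and ideals inside the Heisenberg set. -/

section Heisenberg

variable {ι V N : Type*} [Finite ι] [AddCommGroup V] [Module ℚ V] [AddCommGroup N] [Module ℚ N]
  {P : RootPairing ι ℚ V N} [P.IsRootSystem] [P.IsCrystallographic] [P.IsReduced]
  {B : P.RootPositiveForm ℚ} {b : P.Base} {θ μ : ι} {w : AffineSpace V ≃ₗ[ℚ] AffineSpace V}

lemma refl_mem_finiteWeyl {i : ι} (hi : i ∈ b.support) :
    affRefl B (emb (P.root i)) ∈ finiteWeyl B b := by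
  rw [← refl_eq_affRefl]
  exact Subgroup.subset_closure ⟨i, hi, rfl⟩

lemma finiteWeyl_apply_snd (hw : w ∈ finiteWeyl B b) (x : AffineSpace V) : (w x).2 = x.2 := by
  rw [finiteWeyl] at hw
  induction hw using Subgroup.closure_induction generalizing x with
  | mem g hg =>
    obtain ⟨i, -, rfl⟩ := hg
    simp [refl_eq_affRefl, affRefl_apply]
  | one => rfl
  | mul g h _ _ hg hh => rw [LinearEquiv.mul_apply, hg, hh]
  | inv g _ hg =>
    rw [← hg (g⁻¹ x)]
    simp

lemma exists_eq_emb_root {a : AffineSpace V} (ha : a ∈ affRoots P) (h0 : a.2.1 = 0) :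
    ∃ i, a = emb (P.root i) := by
  obtain ⟨i, k, rfl⟩ := ha
  refine ⟨i, ?_⟩
  have : (k : ℚ) = 0 := by simpa using h0
  simp [this]

lemma mem_affinePos_of_one_le {a : AffineSpace V} (ha : a ∈ affRoots P) (h0 : 1 ≤ a.2.1) :
    a ∈ affinePos b := by
  obtain ⟨i, k, rfl⟩ := ha
  refine Or.inr ⟨i, k, ?_, rfl⟩
  have : 1 ≤ (k : ℚ) := by simpa using h0
  exact_mod_cast this

lemma exists_finiteWeyl_apply_eq (hw : w ∈ finiteWeyl B b) (i : ι) :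
    ∃ j, w (emb (P.root i)) = emb (P.root j) := by
  apply exists_eq_emb_root ((map_mem_affRoots (finiteWeyl_le_affAut B b hw)).mpr
    (emb_root_mem_affRoots i))
  rw [finiteWeyl_apply_snd hw]
  rfl

lemma eq_zero_of_mem_inversionSet (hθ : IsHighestRoot b θ) (hw : w ∈ finiteWeyl B b)
    {a : AffineSpace V} (ha : a ∈ inversionSet b w) : a.2.1 = 0 := by
  have hwA := finiteWeyl_le_affAut B b hw
  obtain ⟨i, hi, h⟩ | ⟨i, k, hk, h⟩ := ha.1
  · rw [h]; rfl
  · refine absurd ha.2 (neg_notMem_affinePos hθ (mem_affinePos_of_one_le ?_ ?_))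
    · exact (map_mem_affRoots hwA).mpr ((mem_affinePos_iff hθ).mp ha.1).1
    · rw [finiteWeyl_apply_snd hw, h]
      have : (1 : ℚ) ≤ k := by exact_mod_cast hk
      simpa using this

lemma finite_inversionSet (hθ : IsHighestRoot b θ)
    (h0 : ∀ a ∈ inversionSet b w, a.2.1 = 0) : (inversionSet b w).Finite := by
  refine (Set.finite_range fun i ↦ emb (P.root i)).subset fun a ha ↦ ?_
  obtain ⟨i, rfl⟩ := exists_eq_emb_root ((mem_affinePos_iff hθ).mp ha.1).1 (h0 a ha)
  exact ⟨i, rfl⟩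

/-- An element of the affine Weyl group with inversions in the finite root system lies in the finite
Weyl group. -/
lemma mem_finiteWeyl_of_inversionSet (hθ : IsHighestRoot b θ) (hw : w ∈ affineWeyl B b θ)
    (h0 : ∀ a ∈ inversionSet b w, a.2.1 = 0) : w ∈ finiteWeyl B b := by
  obtain ⟨n, hn⟩ : ∃ n, (inversionSet b w).ncard = n := ⟨_, rfl⟩
  induction n generalizing w with
  | zero =>
    rw [Set.ncard_eq_zero (finite_inversionSet hθ h0)] at hn
    rw [eq_one_of_inversionSet_eq_empty hθ hw hn]
    exact one_mem _
  | succ n ih =>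
    obtain ⟨c, hc, hcw⟩ := exists_simpleRoot_mem_inversionSet hθ (affineWeyl_le_affAut B b θ hw)
      (Set.nonempty_of_ncard_ne_zero (by omega))
    have hN := inversionSet_mul_affRefl (B := B) hθ hc hcw
    have hwc := mul_mem hw (affRefl_mem_affineWeyl B hc)
    obtain rfl | ⟨i, hi, rfl⟩ := hc
    -- The root α₀ has level 1, so the simple inversion is a finite one.
    · have := h0 _ hcw
      simp [alphaZero] at this
    · have h1 : w * affRefl B (emb (P.root i)) ∈ finiteWeyl B b := by
        refine ih hwc ?_ ?_
        · rw [hN]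
          rintro - ⟨a, ha, rfl⟩
          rw [finiteWeyl_apply_snd (refl_mem_finiteWeyl hi)]
          exact h0 a ha.1
        · rw [hN, Set.ncard_image_of_injective _ (LinearEquiv.injective _),
            Set.ncard_sdiff_singleton_of_mem hcw, hn]
          rfl
      simpa [mul_assoc, affRefl_mul_self] using mul_mem h1 (refl_mem_finiteWeyl hi)

lemma affineForm_alphaZero (hx : AffineSpace V) :
    affineForm B (alphaZero P θ) hx = hx.2.2 - B.form (P.root θ) hx.1 := by
  simp [affineForm_apply, alphaZero]

lemma affRefl_alphaZero_apply (γ : ι) (k : ℚ) :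
    affRefl B (alphaZero P θ) (emb (P.root γ) + k • delta) =
      emb (P.root γ) + k • delta + (P.pairingIn ℤ γ θ : ℚ) • alphaZero P θ := by
  have h := two_mul_form_root_root B γ θ
  have h1 := (form_root_pos B θ).ne'
  rw [affRefl_apply, sub_eq_add_neg, ← neg_smul, affineForm_alphaZero, affineForm_alphaZero]
  congr 2
  simp only [alphaZero, emb_fst, emb_snd, delta_snd_snd, Prod.snd_add, Prod.snd_sub,
    Prod.fst_add, Prod.fst_sub, Prod.smul_fst, Prod.smul_snd, delta_fst, smul_zero,
    Prod.snd_zero, map_neg, smul_eq_mul, mul_zero, add_zero, sub_zero, zero_sub, neg_neg]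
  rw [form_comm B (P.root θ) (P.root γ)]
  field_simp
  linarith

lemma affRefl_alphaZero_delta_sub (γ : ι) :
    affRefl B (alphaZero P θ) (delta - emb (P.root γ)) =
      delta - emb (P.root γ) - (P.pairingIn ℤ γ θ : ℚ) • alphaZero P θ := by
  have h := affRefl_alphaZero_apply (B := B) (θ := θ) (P.reflectionPerm γ γ) 1
  rw [P.root_reflectionPerm, P.reflection_apply_self, P.pairingIn_reflectionPerm_self_left,
    emb_neg, one_smul] at h
  rw [sub_eq_add_neg, add_comm, h]
  push_cast
  module

lemma alphaZero_mem_simpleRoots : alphaZero P θ ∈ simpleRoots b θ := Set.mem_insert _ _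

lemma affRefl_alphaZero_self : affRefl B (alphaZero P θ) (alphaZero P θ) = -alphaZero P θ :=
  affRefl_apply_self B (affineForm_alphaZero_ne_zero B θ)

lemma mul_reflZero_alphaZero (hw : w ∈ affAut B) :
    (w * reflZero B θ) (alphaZero P θ) + delta = w (emb (P.root θ)) := by
  rw [reflZero_eq_affRefl, LinearEquiv.mul_apply, affRefl_alphaZero_self, alphaZero, map_neg,
    map_sub, map_delta hw]
  abel

lemma mem_affineWeyl_mul_reflZero (hw : w ∈ affineWeyl B b θ) :
    w * reflZero B θ ∈ affineWeyl B b θ := by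
  rw [reflZero_eq_affRefl]
  exact mul_mem hw (affRefl_mem_affineWeyl B alphaZero_mem_simpleRoots)

lemma mul_reflZero_mul_reflZero : w * reflZero B θ * reflZero B θ = w := by
  rw [reflZero_eq_affRefl, mul_assoc, affRefl_mul_self, mul_one]

/-- If γ ⊥ θ, then s₀ fixes δ - γ and w keeps it at level 1, hence positive. -/
lemma IsMinuscule.subset_heisenbergRoots (hθ : IsHighestRoot b θ)
    (hw' : w ∈ finiteWeyl B b) (hw : IsMinuscule B b θ (w * reflZero B θ)) :
    idealOf b (w * reflZero B θ) ⊆ heisenbergRoots B b θ := by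
  intro γ hγ
  refine ⟨hγ.1, (hθ.form_nonneg hγ.1).lt_of_ne fun h ↦ ?_⟩
  refine neg_notMem_affinePos hθ ?_ hγ.2.2
  refine mem_affinePos_of_one_le
    ((map_mem_affRoots hw.mem_affAut).mpr (delta_sub_mem_affRoots γ)) ?_
  rw [LinearEquiv.mul_apply, finiteWeyl_apply_snd hw', reflZero_eq_affRefl,
    affRefl_apply_of_orthogonal]
  · simp
  · rw [affineForm_alphaZero]
    simp [← h]

/-- A nontrivial w inverts some simple root, which can only be α₀, as the others have level 0. Right
multiplication by s₀ removes α₀ and sends every other inversion δ - γ to θ - γ, so no inversion of w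
s₀ is off level 0. -/
lemma IsMinuscule.mul_reflZero_mem_finiteWeyl (hθ : IsHighestRoot b θ)
    (hw : IsMinuscule B b θ w) (h1 : w ≠ 1) (hsub : idealOf b w ⊆ heisenbergRoots B b θ) :
    w * reflZero B θ ∈ finiteWeyl B b := by
  refine mem_finiteWeyl_of_inversionSet hθ (mem_affineWeyl_mul_reflZero hw.1) ?_
  have hα : alphaZero P θ ∈ inversionSet b w := by
    obtain ⟨c, hc, hcw⟩ := exists_simpleRoot_mem_inversionSet hθ hw.mem_affAut <| by
      rw [hw.inversionSet_eq]
      exact (hw.idealOf_nonempty hθ h1).image _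
    obtain rfl | ⟨i, -, rfl⟩ := hc
    · exact hcw
    · rw [hw.inversionSet_eq] at hcw
      obtain ⟨γ, -, hγ⟩ := hcw
      simpa using congrArg (·.2.1) hγ
  rw [reflZero_eq_affRefl, inversionSet_mul_affRefl hθ alphaZero_mem_simpleRoots hα,
    hw.inversionSet_eq]
  rintro - ⟨-, ⟨⟨γ, hγ, rfl⟩, hne⟩, rfl⟩
  have hγθ : γ ≠ θ := by
    rintro rfl
    exact hne rfl
  have hp : P.pairingIn ℤ γ θ = 1 := by
    have h2 := hθ.pairingIn_le_one B hγθ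
    have h3 := (hsub hγ).2
    rw [form_comm, form_root_root_pos_iff] at h3
    omega
  rw [affRefl_alphaZero_delta_sub, hp]
  simp [alphaZero]

lemma IsMinuscule.affHt_pos_of_orthogonal (hθ : IsHighestRoot b θ)
    (hw : IsMinuscule B b θ (w * reflZero B θ)) {γ : ι} (hγ : b.IsPos γ)
    (h0 : B.form (P.root θ) (P.root γ) = 0) : 0 < affHt b θ (w (emb (P.root γ))) := by
  have h1 : (w * reflZero B θ) (emb (P.root γ)) = w (emb (P.root γ)) := by
    rw [LinearEquiv.mul_apply, reflZero_eq_affRefl, affRefl_apply_of_orthogonal]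
    rw [affineForm_alphaZero]
    simp [h0]
  rw [← h1]
  refine ((mem_affinePos_iff hθ).mp (map_mem_affinePos hθ hw.mem_affAut (Or.inl ⟨γ, hγ, rfl⟩)
    fun h ↦ ?_)).2
  rw [hw.inversionSet_eq] at h
  obtain ⟨κ, -, hκ⟩ := h
  simpa using congrArg (·.2.1) hκ

lemma affRefl_alphaZero_two_smul_delta_sub :
    affRefl B (alphaZero P θ) ((2 : ℚ) • delta - emb (P.root θ)) = emb (P.root θ) := by
  have h := affRefl_alphaZero_apply (B := B) (θ := θ) (P.reflectionPerm θ θ) 2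
  rw [P.root_reflectionPerm, P.reflection_apply_self, P.pairingIn_reflectionPerm_self_left,
    P.pairingIn_same, emb_neg] at h
  rw [sub_eq_add_neg, add_comm, h, alphaZero]
  push_cast
  module

/-- Since s₀(2δ - θ) = θ, a negative μ would make 2δ - θ an inversion at level 2. -/
lemma IsMinuscule.isPos_of_map_highestRoot
    (hw : IsMinuscule B b θ (w * reflZero B θ)) (hμ : w (emb (P.root θ)) = emb (P.root μ)) :
    b.IsPos μ := by
  by_contra h
  have hmem : (2 : ℚ) • delta - emb (P.root θ) ∈ inversionSet b (w * reflZero B θ) := by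
    refine ⟨Or.inr ⟨P.reflectionPerm θ θ, 2, by norm_num, ?_⟩, ?_⟩
    · rw [P.root_reflectionPerm, P.reflection_apply_self, emb_neg]
      push_cast
      abel
    · rw [LinearEquiv.mul_apply, reflZero_eq_affRefl, affRefl_alphaZero_two_smul_delta_sub, hμ,
        ← emb_neg]
      exact Or.inl ⟨P.reflectionPerm μ μ, isPos_reflectionPerm_self.mpr h, by simp⟩
  rw [hw.inversionSet_eq] at hmem
  obtain ⟨γ, -, hγ⟩ := hmem
  have := congrArg (·.2.1) hγ
  norm_num at this

/-- For an inversion γ + kδ of w s₀ the level k + ⟨γ, θ^∨⟩ after s₀ is at most 0, since w preserves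
levels. With ⟨γ, θ^∨⟩ ≥ -1 for γ ≠ -θ, few cases survive; the two assumptions on w remove those that
are not of the form δ - (positive root). -/
lemma isMinuscule_mul_reflZero (hθ : IsHighestRoot b θ) (hw : w ∈ finiteWeyl B b)
    (hμ : w (emb (P.root θ)) = emb (P.root μ)) (hμpos : b.IsPos μ)
    (h : ∀ γ, b.IsPos γ → B.form (P.root θ) (P.root γ) = 0 →
      0 < affHt b θ (w (emb (P.root γ)))) :
    IsMinuscule B b θ (w * reflZero B θ) := by
  have hwA := finiteWeyl_le_affAut B b hw
  have hwW := mem_affineWeyl_mul_reflZero (finiteWeyl_le_affineWeyl B b θ hw)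
  have hwsA := affineWeyl_le_affAut B b θ hwW
  refine ⟨hwW, idealOf b (w * reflZero B θ), fun γ hγ ↦ hγ.1, ?_⟩
  refine Set.Subset.antisymm (fun a ha ↦ ?_) (by rintro - ⟨γ, hγ, rfl⟩; exact hγ.2)
  have haR := (mem_affinePos_iff hθ).mp ha.1
  suffices ∃ γ, b.IsPos γ ∧ a = delta - emb (P.root γ) by
    obtain ⟨γ, hγ, rfl⟩ := this
    exact ⟨γ, ⟨hγ, ha⟩, rfl⟩
  have hneg : ((w * reflZero B θ) a).2.1 < 1 := by
    by_contra! h1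
    exact neg_notMem_affinePos hθ (mem_affinePos_of_one_le ((map_mem_affRoots hwsA).mpr haR.1) h1)
      ha.2
  rw [LinearEquiv.mul_apply, finiteWeyl_apply_snd hw, reflZero_eq_affRefl] at hneg
  have ha2 := ha.2
  rw [LinearEquiv.mul_apply, reflZero_eq_affRefl] at ha2
  obtain ⟨⟨i, hi, rfl⟩ | ⟨i, k, hk, rfl⟩, -⟩ := ha
  · exfalso
    have h1 := affRefl_alphaZero_apply (B := B) (θ := θ) i 0
    rw [zero_smul, add_zero] at h1
    rw [h1] at hneg
    have h2 : P.pairingIn ℤ i θ < 1 := by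
      have : (P.pairingIn ℤ i θ : ℚ) < 1 := by simpa [alphaZero] using hneg
      exact_mod_cast this
    have h3 : 0 ≤ P.pairingIn ℤ i θ := by
      rw [← form_root_root_nonneg_iff (B := B), form_comm]
      exact hθ.form_nonneg hi
    have h4 : P.pairingIn ℤ i θ = 0 := by omega
    rw [h1, h4, Int.cast_zero, zero_smul, add_zero] at ha2
    have h5 := h i hi (by rw [form_comm, form_root_root_eq_zero_iff, h4])
    have h6 := ((mem_affinePos_iff hθ).mp ha2).2
    rw [map_neg] at h6
    linarith
  · have h1 := affRefl_alphaZero_apply (B := B) (θ := θ) i k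
    rw [h1] at hneg
    have h2 : k + P.pairingIn ℤ i θ < 1 := by
      have : (k + P.pairingIn ℤ i θ : ℚ) < 1 := by simpa [alphaZero] using hneg
      exact_mod_cast this
    by_cases hiθ : P.root i = -P.root θ
    · have hip : P.pairingIn ℤ i θ = -2 := by
        have : i = P.reflectionPerm θ θ := P.root.injective <| by
          rw [hiθ, P.root_reflectionPerm, P.reflection_apply_self]
        rw [this, P.pairingIn_reflectionPerm_self_left, P.pairingIn_same]
      -- k = 1 is α₀ itself; k = 2 is sent to θ by s₀ and then to the positive root μ.
      obtain rfl | hk2 : k = 1 ∨ k = 2 := by omega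
      · exact ⟨θ, hθ.isPos, by rw [hiθ, emb_neg]; simp; abel⟩
      · exfalso
        have h3 : emb (P.root i) + (k : ℚ) • delta = (2 : ℚ) • delta - emb (P.root θ) := by
          rw [hiθ, hk2, emb_neg]
          push_cast
          abel
        rw [h3, affRefl_alphaZero_two_smul_delta_sub, hμ] at ha2
        exact neg_notMem_affinePos hθ (Or.inl ⟨μ, hμpos, rfl⟩) ha2
    · have h3 := hθ.neg_one_le_pairingIn B hiθ
      have hk1 : k = 1 := by omega
      refine ⟨P.reflectionPerm i i, ?_, ?_⟩
      · rw [isPos_reflectionPerm_self]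
        intro hi
        have h4 := hθ.form_nonneg (B := B) hi
        rw [form_comm, form_root_root_nonneg_iff] at h4
        omega
      · rw [P.root_reflectionPerm, P.reflection_apply_self, emb_neg, hk1]
        simp
        abel

/-- The element u = w⁻¹v fixes θ. If u takes a positive γ to a negative γ', then (θ, γ) = (θ, γ') is
both ≥ 0 and ≤ 0, so both roots are orthogonal to θ. Then v γ > 0 and w(-γ') = -v γ > 0 contradict
each other. -/
lemma eq_of_map_highestRoot_eq (hθ : IsHighestRoot b θ)
    {v : AffineSpace V ≃ₗ[ℚ] AffineSpace V} (hv : v ∈ finiteWeyl B b) (hw : w ∈ finiteWeyl B b)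
    (heq : v (emb (P.root θ)) = w (emb (P.root θ)))
    (hv0 : ∀ γ, b.IsPos γ → B.form (P.root θ) (P.root γ) = 0 →
      0 < affHt b θ (v (emb (P.root γ))))
    (hw0 : ∀ γ, b.IsPos γ → B.form (P.root θ) (P.root γ) = 0 →
      0 < affHt b θ (w (emb (P.root γ)))) : v = w := by
  have hu : w⁻¹ * v ∈ finiteWeyl B b := mul_mem (inv_mem hw) hv
  have huA := finiteWeyl_le_affAut B b hu
  have huθ : (w⁻¹ * v) (emb (P.root θ)) = emb (P.root θ) := by
    rw [LinearEquiv.mul_apply, heq]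
    simp
  suffices inversionSet b (w⁻¹ * v) = ∅ from
    (inv_mul_eq_one.mp (eq_one_of_inversionSet_eq_empty hθ
      (finiteWeyl_le_affineWeyl B b θ hu) this)).symm
  rw [Set.eq_empty_iff_forall_notMem]
  intro a ha
  obtain ⟨i, rfl⟩ := exists_eq_emb_root ((mem_affinePos_iff hθ).mp ha.1).1
    (eq_zero_of_mem_inversionSet hθ hu ha)
  have hi : b.IsPos i := isPos_iff_htFun.mpr (by simpa using ((mem_affinePos_iff hθ).mp ha.1).2)
  obtain ⟨j, hj⟩ := exists_finiteWeyl_apply_eq hu i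
  have hform : B.form (P.root θ) (P.root j) = B.form (P.root θ) (P.root i) := by
    have := affineForm_map huA (emb (P.root θ)) (emb (P.root i))
    rwa [huθ, hj, affineForm_emb_emb, affineForm_emb_emb] at this
  have hjneg : ¬ b.IsPos j := fun h ↦ by
    have := ha.2
    rw [hj] at this
    exact neg_notMem_affinePos hθ (Or.inl ⟨j, h, rfl⟩) this
  have hj' := isPos_reflectionPerm_self.mpr hjneg
  have h1 := hθ.form_nonneg (B := B) hj'
  have h2 := hθ.form_nonneg (B := B) hi
  rw [P.root_reflectionPerm, P.reflection_apply_self, map_neg] at h1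
  have h3 := hv0 i hi (by linarith)
  have h4 := hw0 _ hj' (by
    rw [P.root_reflectionPerm, P.reflection_apply_self, map_neg]; linarith)
  rw [P.root_reflectionPerm, P.reflection_apply_self, emb_neg, ← hj] at h4
  simp only [LinearEquiv.mul_apply, map_neg] at h4
  have h5 : w (w⁻¹ (v (emb (P.root i)))) = v (emb (P.root i)) := by
    rw [← LinearEquiv.mul_apply, mul_inv_cancel]
    rfl
  rw [h5] at h4
  linarith

/-- Take a root of largest height in the orbit: a negative pairing with a simple root would let that
reflection raise the height. -/
lemma exists_dominant (B : P.RootPositiveForm ℚ) (b : P.Base) (i : ι) :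
    ∃ w ∈ finiteWeyl B b, ∃ j, w (emb (P.root i)) = emb (P.root j) ∧
      ∀ k ∈ b.support, 0 ≤ B.form (P.root j) (P.root k) := by
  obtain ⟨j, ⟨w, hw, hwj⟩, hmax⟩ :=
    (Set.toFinite {j | ∃ w ∈ finiteWeyl B b, w (emb (P.root i)) = emb (P.root j)}).exists_maximalFor
      (fun j ↦ htFun b (P.root j)) _ ⟨i, 1, one_mem _, rfl⟩
  refine ⟨w, hw, j, hwj, fun k hk ↦ ?_⟩
  rw [form_root_root_nonneg_iff]
  by_contra! h
  have h1 : affRefl B (emb (P.root k)) (emb (P.root j)) = emb (P.root (P.reflectionPerm k j)) := by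
    simpa using affRefl_affRoot_apply B k j 0 0
  have h2 : htFun b (P.root (P.reflectionPerm k j)) =
      htFun b (P.root j) - P.pairingIn ℤ j k := by
    rw [P.root_reflectionPerm, P.reflection_apply_root' ℤ, map_sub, map_zsmul,
      htFun_of_mem_support hk]
    simp
  have h3 : (P.pairingIn ℤ j k : ℚ) < 0 := by exact_mod_cast h
  have h4 := hmax (j := P.reflectionPerm k j)
    ⟨_, mul_mem (refl_mem_finiteWeyl hk) hw, by rw [LinearEquiv.mul_apply, hwj, h1]⟩
    (by simp only [h2]; linarith)
  simp only [h2] at h4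
  linarith

lemma form_le_form_highestRoot (hθ : IsHighestRoot b θ) {j : ι}
    (hj : ∀ k ∈ b.support, 0 ≤ B.form (P.root j) (P.root k)) :
    B.form (P.root j) (P.root j) ≤ B.form (P.root j) (P.root θ) := by
  simpa using nonneg_of_mem_closure hj (hθ j)

lemma form_finiteWeyl (hw : w ∈ finiteWeyl B b) {i j : ι}
    (h : w (emb (P.root i)) = emb (P.root j)) :
    B.form (P.root i) (P.root i) = B.form (P.root j) (P.root j) := by
  rw [← affineForm_emb_emb, ← affineForm_emb_emb, ← h,
    affineForm_map (finiteWeyl_le_affAut B b hw)]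

/-- A dominant conjugate γ of any root satisfies (γ, γ) ≤ (γ, θ) ≤ (θ, θ), since θ - γ is a sum of
simple roots and both γ and θ are dominant. -/
lemma IsHighestRoot.mem_longPos (B : P.RootPositiveForm ℚ) (hθ : IsHighestRoot b θ) :
    θ ∈ longPos B b := by
  refine ⟨hθ.isPos, fun i ↦ ?_⟩
  obtain ⟨w, hw, j, hwj, hj⟩ := exists_dominant B b i
  rw [form_finiteWeyl hw hwj]
  have h1 := form_le_form_highestRoot hθ hj
  have h2 := nonneg_of_mem_closure (f := B.form (P.root θ))
    (fun k hk ↦ hθ.form_nonneg (b.isPos_of_mem_support hk)) (hθ j)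
  rw [map_sub] at h2
  rw [form_comm B (P.root j) (P.root θ)] at h1
  linarith

/-- The dominant conjugate γ of μ is θ. Otherwise γ - θ would be a root, while (γ, θ) ≥ (γ, γ) ≥ (θ,
θ) makes its square length at most 0. -/
lemma exists_finiteWeyl_map_highestRoot (hθ : IsHighestRoot b θ) (hμ : μ ∈ longPos B b) :
    ∃ w ∈ finiteWeyl B b, w (emb (P.root θ)) = emb (P.root μ) := by
  obtain ⟨w, hw, j, hwj, hj⟩ := exists_dominant B b μ
  suffices j = θ by
    refine ⟨w⁻¹, inv_mem hw, ?_⟩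
    rw [← this, ← hwj]
    simp
  have h1 := form_le_form_highestRoot hθ hj
  have h2 := form_finiteWeyl hw hwj
  have h3 := hμ.2 θ
  by_contra hne
  obtain ⟨k, hk⟩ := root_sub_root_mem_of_form_pos (B := B) (i := j) (j := θ)
    ((form_root_pos B j).trans_le h1) hne
  have h4 := form_root_pos B k
  rw [hk] at h4
  simp only [map_sub, LinearMap.sub_apply, form_comm B (P.root θ) (P.root j)] at h4
  linarith

/-- The shortest element of the finite Weyl group that maps `θ` to a given long root. -/
lemma exists_minimal_finiteWeyl_map_highestRoot (hθ : IsHighestRoot b θ) (hμ : μ ∈ longPos B b) :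
    ∃ w ∈ finiteWeyl B b, w (emb (P.root θ)) = emb (P.root μ) ∧
      ∀ γ, b.IsPos γ → B.form (P.root θ) (P.root γ) = 0 →
        0 < affHt b θ (w (emb (P.root γ))) := by
  obtain ⟨w, hw, hwθ⟩ := exists_finiteWeyl_map_highestRoot hθ hμ
  obtain ⟨n, hn⟩ : ∃ n, (inversionSet b w).ncard = n := ⟨_, rfl⟩
  induction n generalizing w with
  | zero =>
    rw [Set.ncard_eq_zero (finite_inversionSet hθ fun a ↦ eq_zero_of_mem_inversionSet hθ hw)] at hn
    rw [eq_one_of_inversionSet_eq_empty hθ (finiteWeyl_le_affineWeyl B b θ hw) hn] at hwθ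
    refine ⟨1, one_mem _, hwθ, fun γ hγ _ ↦ ?_⟩
    simpa using isPos_iff_htFun.mp hγ
  | succ n ih =>
    by_cases h : ∃ i ∈ b.support, B.form (P.root θ) (P.root i) = 0 ∧
        emb (P.root i) ∈ inversionSet b w
    -- Reflecting in such a simple root fixes θ and removes one inversion.
    · obtain ⟨i, hi, hi0, hiw⟩ := h
      refine ih _ (mul_mem hw (refl_mem_finiteWeyl (B := B) hi)) ?_ ?_
      · rw [LinearEquiv.mul_apply, affRefl_apply_of_orthogonal, hwθ]
        rw [affineForm_emb_emb, form_comm, hi0]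
      · rw [inversionSet_mul_affRefl hθ (Or.inr ⟨i, hi, rfl⟩) hiw,
          Set.ncard_image_of_injective _ (LinearEquiv.injective _),
          Set.ncard_sdiff_singleton_of_mem hiw, hn]
        rfl
    · push Not at h
      refine ⟨w, hw, hwθ, fun γ hγ ↦ ?_⟩
      suffices b.IsPos γ ∧ (B.form (P.root θ) (P.root γ) = 0 →
        0 < affHt b θ (w (emb (P.root γ)))) from this.2
      -- By dominance of θ, a positive root orthogonal to θ has only simple summands orthogonal to
      -- θ, so simple roots suffice.
      have hsimple (i) (hi : i ∈ b.support) : b.IsPos i ∧ (B.form (P.root θ) (P.root i) = 0 →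
          0 < affHt b θ (w (emb (P.root i)))) := by
        refine ⟨b.isPos_of_mem_support hi, fun hi0 ↦ ?_⟩
        exact ((mem_affinePos_iff hθ).mp (map_mem_affinePos hθ (finiteWeyl_le_affAut B b hw)
          (Or.inl ⟨i, b.isPos_of_mem_support hi, rfl⟩) (h i hi hi0))).2
      refine hγ.induction_on_add (p := fun γ ↦ b.IsPos γ ∧ (B.form (P.root θ) (P.root γ) = 0 →
        0 < affHt b θ (w (emb (P.root γ))))) hsimple ?_
      rintro i j k hk ⟨hi, hi'⟩ hj
      obtain ⟨hjp, hj'⟩ := hsimple j hj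
      refine ⟨hi.add hjp hk, fun h0 ↦ ?_⟩
      have h1 := hθ.form_nonneg (B := B) hi
      have h2 := hθ.form_nonneg (B := B) hjp
      rw [hk, map_add] at h0
      rw [hk, emb_add, map_add, map_add]
      exact add_pos (hi' (by linarith)) (hj' (by linarith))

end Heisenberg

/-! ### Least elements of the rootlet fibres. -/

section MinimalIdeals

variable {ι V N : Type*} [Finite ι] [AddCommGroup V] [Module ℚ V] [AddCommGroup N] [Module ℚ N]
  {P : RootPairing ι ℚ V N} [P.IsRootSystem] [P.IsCrystallographic] [P.IsReduced]
  {B : P.RootPositiveForm ℚ} {b : P.Base} {θ μ : ι} {w : AffineSpace V ≃ₗ[ℚ] AffineSpace V}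

lemma ne_one_of_apply_alphaZero {v : V} (h : w (alphaZero P θ) + delta = emb v) : w ≠ 1 := by
  rintro rfl
  have := congrArg (·.2.1) h
  norm_num [alphaZero] at this

lemma IsMinuscule.mem_nontrivialIdeals (hθ : IsHighestRoot b θ) (hw : IsMinuscule B b θ w)
    (h1 : w ≠ 1) : idealOf b w ∈ nontrivialIdeals b :=
  (bijOn_idealOf B hθ).mapsTo ⟨hw, h1⟩

/-- Every fibre of the rootlet map is closed under intersection with the Heisenberg root set. -/
lemma exists_isMinuscule_inter_of_mem_rootletFibre (hθ : IsHighestRoot b θ) {I : Set ι}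
    (hI : I ∈ rootletFibre B b θ μ) :
    ∃ w ∈ finiteWeyl B b, IsMinuscule B b θ (w * reflZero B θ) ∧
      idealOf b (w * reflZero B θ) = I ∩ heisenbergRoots B b θ ∧
      w (emb (P.root θ)) = emb (P.root μ) ∧
      idealOf b (w * reflZero B θ) ∈ rootletFibre B b θ μ := by
  obtain ⟨-, u, hu, rfl, huμ⟩ := hI
  obtain ⟨v, hv, hvI, hv0⟩ := hu.exists_inter_heisenbergRoots hθ
  have hvμ : v (alphaZero P θ) + delta = emb (P.root μ) := by rw [hv0, huμ]
  have hv1 := ne_one_of_apply_alphaZero hvμ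
  have hvW := hv.mul_reflZero_mem_finiteWeyl hθ hv1 (by rw [hvI]; exact Set.inter_subset_right)
  obtain ⟨w, hw, rfl⟩ : ∃ w ∈ finiteWeyl B b, v = w * reflZero B θ :=
    ⟨_, hvW, mul_reflZero_mul_reflZero.symm⟩
  refine ⟨w, hw, hv, hvI, ?_, hv.mem_nontrivialIdeals hθ hv1, _, hv, rfl, hvμ⟩
  rw [← mul_reflZero_alphaZero (finiteWeyl_le_affAut B b hw), hvμ]

/-- For any I in the fibre, the Heisenberg part of I belongs to some v s₀ with v θ = μ. Uniqueness
gives v = w, so the candidate is contained in I. -/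
lemma isMinIdeal_mul_reflZero (hθ : IsHighestRoot b θ) (hw : w ∈ finiteWeyl B b)
    (hmin : IsMinuscule B b θ (w * reflZero B θ)) (hμ : w (emb (P.root θ)) = emb (P.root μ)) :
    IsMinIdeal B b θ μ (idealOf b (w * reflZero B θ)) := by
  have hα : (w * reflZero B θ) (alphaZero P θ) + delta = emb (P.root μ) := by
    rw [mul_reflZero_alphaZero (finiteWeyl_le_affAut B b hw), hμ]
  refine ⟨⟨hmin.mem_nontrivialIdeals hθ (ne_one_of_apply_alphaZero hα), _, hmin, rfl, hα⟩,
    fun I hI ↦ ?_⟩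
  obtain ⟨v, hv, hvmin, hvI, hvμ, -⟩ := exists_isMinuscule_inter_of_mem_rootletFibre hθ hI
  have hwv := eq_of_map_highestRoot_eq hθ hw hv (by rw [hμ, hvμ])
    (fun γ ↦ hmin.affHt_pos_of_orthogonal hθ) (fun γ ↦ hvmin.affHt_pos_of_orthogonal hθ)
  rw [hwv, hvI]
  exact Set.inter_subset_left

lemma exists_isMinIdeal (hθ : IsHighestRoot b θ) (hμ : μ ∈ longPos B b) :
    ∃ I, IsMinIdeal B b θ μ I := by
  obtain ⟨w, hw, hwμ, h⟩ := exists_minimal_finiteWeyl_map_highestRoot hθ hμ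
  exact ⟨_, isMinIdeal_mul_reflZero hθ hw (isMinuscule_mul_reflZero hθ hw hwμ hμ.1 h) hwμ⟩

lemma IsMinIdeal.subset_heisenbergRoots (hθ : IsHighestRoot b θ) {I : Set ι}
    (hI : IsMinIdeal B b θ μ I) : I ⊆ heisenbergRoots B b θ := by
  obtain ⟨v, -, -, hvI, -, hv⟩ := exists_isMinuscule_inter_of_mem_rootletFibre hθ hI.1
  have := hI.2 hv
  rw [hvI] at this
  exact this.trans Set.inter_subset_right

lemma IsMinIdeal.root_eq (hθ : IsHighestRoot b θ) {I : Set ι} {ν : ι}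
    (hI : IsMinIdeal B b θ μ I) (hI' : IsMinIdeal B b θ ν I) : μ = ν := by
  obtain ⟨-, v, hv, hvI, hvμ⟩ := hI.1
  obtain ⟨-, w, hw, hwI, hwν⟩ := hI'.1
  rw [hv.eq_of_idealOf_eq hθ hw (by rw [hvI, hwI]), hwν] at hvμ
  exact (P.root.injective (emb_injective hvμ)).symm

/-- The characterisations of the minimal ideals. -/
lemma IsMinuscule.tfae (hθ : IsHighestRoot b θ) (hw : IsMinuscule B b θ w) (h1 : w ≠ 1) :
    List.TFAE [
      ∃ μ ∈ longPos B b, IsMinIdeal B b θ μ (idealOf b w),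
      idealOf b w ⊆ heisenbergRoots B b θ,
      ∃ w' ∈ finiteWeyl B b, w = w' * reflZero B θ] := by
  tfae_have 1 → 2 := fun ⟨_, _, h⟩ ↦ h.subset_heisenbergRoots hθ
  tfae_have 2 → 3 := fun h ↦
    ⟨_, hw.mul_reflZero_mem_finiteWeyl hθ h1 h, mul_reflZero_mul_reflZero.symm⟩
  tfae_have 3 → 1 := by
    rintro ⟨w', hw', rfl⟩
    obtain ⟨μ, hμ⟩ := exists_finiteWeyl_apply_eq hw' θ
    refine ⟨μ, ⟨hw.isPos_of_map_highestRoot hμ, fun j ↦ ?_⟩, isMinIdeal_mul_reflZero hθ hw' hw hμ⟩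
    rw [← form_finiteWeyl hw' hμ]
    exact (hθ.mem_longPos B).2 j
  tfae_finish

lemma exists_longPos_equiv (B : P.RootPositiveForm ℚ) (hθ : IsHighestRoot b θ) :
    ∃ e : longPos B b ≃ {I // I ∈ nontrivialIdeals b ∧ I ⊆ heisenbergRoots B b θ},
      ∀ μ : longPos B b, IsMinIdeal B b θ μ (e μ) := by
  choose f hf using fun μ : longPos B b ↦ exists_isMinIdeal hθ μ.2
  refine ⟨Equiv.ofBijective (fun μ ↦ ⟨f μ, (hf μ).1.1, (hf μ).subset_heisenbergRoots hθ⟩)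
    ⟨fun μ ν h ↦ ?_, ?_⟩, hf⟩
  · have hμν : f μ = f ν := congrArg Subtype.val h
    exact Subtype.ext ((hf μ).root_eq hθ (hμν ▸ hf ν))
  · rintro ⟨I, hI, hsub⟩
    obtain ⟨w, ⟨hw, h1⟩, rfl⟩ := (bijOn_idealOf B hθ).surjOn hI
    obtain ⟨μ, hμ, hμI⟩ := ((hw.tfae hθ h1).out 0 1).mpr hsub
    exact ⟨⟨μ, hμ⟩, Subtype.ext ((hf ⟨μ, hμ⟩).unique hμI)⟩

end MinimalIdeals

/-! ### The rational root system and brackets of root spaces. -/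

section Lie

open LieAlgebra LieAlgebra.IsKilling LieModule

variable {K L : Type*} [Field K] [CharZero K] [LieRing L] [LieAlgebra K L] [FiniteDimensional K L]
  [IsKilling K L] {H : LieSubalgebra K L} [H.IsCartanSubalgebra] [IsTriangularizable K H L]

/-- Transfers integrality and reducedness from the root system over K to the one over ℚ. -/
lemma algebraMap_ratRootSystem_pairing (i j : H.root) :
    algebraMap ℚ K ((ratRootSystem H).pairing i j) = (rootSystem H).pairing i j :=
  let _i : Module ℚ (Module.Dual K H) := Module.compHom _ (algebraMap ℚ K)
  let _i : Module ℚ H := Module.compHom _ (algebraMap ℚ K)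
  have := RootPairing.IsValuedIn.trans (rootSystem H) ℚ ℤ
  RootPairing.restrictScalars_pairing (K := ℚ) (P := rootSystem H) i j

lemma isCrystallographic_ratRootSystem : (ratRootSystem H).IsCrystallographic where
  exists_value i j := by
    refine ⟨(rootSystem H).pairingIn ℤ i j, ?_⟩
    apply (algebraMap ℚ K).injective
    rw [algebraMap_ratRootSystem_pairing, ← (rootSystem H).algebraMap_pairingIn ℤ]
    simp

lemma isReduced_ratRootSystem : (ratRootSystem H).IsReduced where
  eq_or_eq_neg i j h := by
    rw [← RootPairing.coxeterWeight_eq_four_iff_not_linearIndependent] at h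
    have h' : (rootSystem H).coxeterWeight i j = 4 := by
      rw [RootPairing.coxeterWeight] at h ⊢
      rw [← algebraMap_ratRootSystem_pairing, ← algebraMap_ratRootSystem_pairing, ← map_mul, h]
      simp
    rw [RootPairing.coxeterWeight_eq_four_iff_not_linearIndependent] at h'
    refine (RootPairing.IsReduced.eq_or_eq_neg i j h').imp (fun h ↦ ?_) fun h ↦ ?_
    · rw [(rootSystem H).root.injective h]
    · exact Subtype.ext h

lemma ratRootSystem_root_eq_add_iff {i j k : H.root} :
    (ratRootSystem H).root k = (ratRootSystem H).root i + (ratRootSystem H).root j ↔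
      (k.1 : H → K) = i.1 + j.1 := by
  constructor
  · intro h
    have := congrArg Subtype.val h
    ext z
    exact congrArg (fun f : Module.Dual K H ↦ f z) this
  · intro h
    apply Subtype.ext
    ext z
    exact congrFun h z

/-- If the sum of a nonzero weight `α` and a weight `β` is a weight, then `[L_α, L_β] ≠ 0`. -/
lemma exists_lie_ne_zero (α β : Weight K H L) (hα : α.IsNonZero)
    (hαβ : rootSpace H ((α : H → K) + (β : H → K)) ≠ ⊥) :
    ∃ x ∈ rootSpace H (α : H → K), ∃ y ∈ rootSpace H (β : H → K), ⁅x, y⁆ ≠ 0 := by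
  have hq : 1 ≤ chainTopCoeff α β := by
    have := ((rootSpace_zsmul_add_ne_bot_iff α β hα 1).mp (by simpa using hαβ)).1
    exact_mod_cast this
  obtain ⟨x, hx, x_ne0⟩ := (chainTop α β).exists_ne_zero
  obtain ⟨h, e, f, isSl2, he, hf⟩ := exists_isSl2Triple_of_weight_isNonZero hα
  obtain rfl := isSl2.h_eq_coroot hα he hf
  have prim : isSl2.HasPrimitiveVectorWith x (chainLength α β : K) :=
    have := lie_mem_genWeightSpace_of_mem_genWeightSpace he hx
    ⟨x_ne0, (chainLength_smul _ _ hx).symm, by rwa [genWeightSpace_add_chainTop _ _ hα] at this⟩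
  obtain ⟨n, hn⟩ : ∃ n, chainTopCoeff α β = n + 1 := ⟨_, (Nat.sub_add_cancel hq).symm⟩
  have hle := chainTopCoeff_le_chainLength α β
  rw [hn] at hle
  -- Descend n + 1 steps from the top of the α-chain to reach weight β. Then e f^(n+1) x = (n + 1)(ℓ
  -- - n) f^n x, with ℓ the chain length, and ℓ > n.
  refine ⟨e, he, ((toEnd K L L) f ^ (n + 1)) x, ?_, ?_⟩
  · have := toEnd_pow_apply_mem hf hx (n + 1)
    convert this using 2
    rw [coe_chainTop', hn]
    module
  · rw [prim.lie_e_pow_succ_toEnd_f]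
    refine smul_ne_zero (mul_ne_zero (by exact_mod_cast n.succ_ne_zero) ?_)
      (prim.pow_toEnd_f_ne_zero_of_eq_nat rfl (by omega))
    rw [sub_ne_zero]
    exact_mod_cast (by omega : chainLength α β ≠ n)

lemma rootSpace_le_of_mem (α : H.root) {S : Submodule K L} {x : L}
    (hx : x ∈ rootSpace H (α.1 : H → K)) (hx0 : x ≠ 0) (hxS : x ∈ S) :
    (rootSpace H (α.1 : H → K)).toSubmodule ≤ S := by
  intro y hy
  have h1 := finrank_rootSpace_eq_one α.1 (H.isNonZero_coe_root α)
  obtain ⟨c, hc⟩ := (finrank_eq_one_iff_of_nonzero' (⟨x, hx⟩ : rootSpace H (α.1 : H → K))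
    (by simpa using hx0)).mp h1 ⟨y, hy⟩
  have : c • x = y := congrArg Subtype.val hc
  rw [← this]
  exact S.smul_mem c hxS

lemma mem_of_rootSpace_le_rootSpaceSum {I : Set H.root} {α : H.root}
    (h : (rootSpace H (α.1 : H → K)).toSubmodule ≤ rootSpaceSum H I) : α ∈ I := by
  by_contra hα
  obtain ⟨x, hx, hx0⟩ := α.1.exists_ne_zero
  have hind := (LieSubmodule.iSupIndep_toSubmodule.mpr (iSupIndep_genWeightSpace' K H L)) α.1
  refine hx0 (Submodule.disjoint_def.mp hind x hx ?_)
  refine (h.trans ?_) hx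
  refine iSup₂_le fun γ hγ ↦ ?_
  refine le_iSup₂_of_le (f := fun (j : Weight K H L) (_ : j ≠ α.1) ↦
    (genWeightSpace L (j : H → K)).toSubmodule) γ.1 (fun h ↦ hα ?_) le_rfl
  rwa [← Subtype.ext h]

lemma rootSpaceSum_injective : Function.Injective (rootSpaceSum H) := by
  intro I J h
  ext α
  constructor
  · intro hα
    apply mem_of_rootSpace_le_rootSpaceSum
    rw [← h]
    exact le_iSup₂_of_le α hα le_rfl
  · intro hα
    apply mem_of_rootSpace_le_rootSpaceSum
    rw [h]
    exact le_iSup₂_of_le α hα le_rfl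

/-- An `H`-submodule of a sum of root spaces is itself a sum of root spaces. -/
lemma eq_rootSpaceSum (S : LieSubmodule K H L) {J : Set H.root}
    (hS : S.toSubmodule ≤ rootSpaceSum H J) :
    S.toSubmodule = rootSpaceSum H
      {α | (rootSpace H (α.1 : H → K)).toSubmodule ≤ S.toSubmodule} := by
  refine le_antisymm ?_ (iSup₂_le fun α hα ↦ hα)
  conv_lhs => rw [eq_iSup_inf_genWeightSpace (N := S)]
  rw [LieSubmodule.iSup_toSubmodule]
  refine iSup_le fun χ x hx ↦ ?_
  by_cases hx0 : x = 0
  · rw [hx0]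
    exact zero_mem _
  obtain ⟨hxS, hxχ⟩ := hx
  by_cases hχ : χ.IsZero
  -- The zero weight cannot occur, as weight spaces are independent and the sum involves nonzero
  -- weights only.
  · exfalso
    have hind := (LieSubmodule.iSupIndep_toSubmodule.mpr (iSupIndep_genWeightSpace' K H L)) χ
    refine hx0 (Submodule.disjoint_def.mp hind x hxχ ((hS.trans ?_) hxS))
    refine iSup₂_le fun γ hγ ↦ ?_
    refine le_iSup₂_of_le (f := fun (j : Weight K H L) (_ : j ≠ χ) ↦
      (genWeightSpace L (j : H → K)).toSubmodule) γ.1 (fun h ↦ ?_) le_rfl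
    exact H.isNonZero_coe_root γ (h ▸ hχ)
  · let α : H.root := ⟨χ, by simpa using hχ⟩
    exact Submodule.mem_iSup_of_mem α (Submodule.mem_iSup_of_mem
      (rootSpace_le_of_mem α hxχ hx0 hxS) hxχ)

end Lie

/-! ### Abelian ideals of the Borel subalgebra as sums of root spaces. -/

section LieIdeals

open LieAlgebra LieAlgebra.IsKilling LieModule

variable {K L : Type*} [Field K] [CharZero K] [LieRing L] [LieAlgebra K L] [FiniteDimensional K L]
  [IsKilling K L] {H : LieSubalgebra K L} [H.IsCartanSubalgebra] [IsTriangularizable K H L]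
  {b : (ratRootSystem H).Base}

lemma rootSpace_le_rootSpaceSum {I : Set H.root} {α : H.root} (hα : α ∈ I) :
    (rootSpace H (α.1 : H → K)).toSubmodule ≤ rootSpaceSum H I :=
  le_iSup₂_of_le α hα le_rfl

lemma lie_mem_rootSpaceSum_of_forall {I : Set H.root} {α β : H.root}
    (hα : b.IsPos α) (hβ : b.IsPos β)
    (hI : ∀ κ, (ratRootSystem H).root κ = (ratRootSystem H).root α + (ratRootSystem H).root β →
      κ ∈ I) {x y : L}
    (hx : x ∈ rootSpace H (α.1 : H → K)) (hy : y ∈ rootSpace H (β.1 : H → K)) :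
    ⁅x, y⁆ ∈ rootSpaceSum H I := by
  have hxy : ⁅x, y⁆ ∈ rootSpace H ((α.1 : H → K) + (β.1 : H → K)) :=
    lie_mem_genWeightSpace_of_mem_genWeightSpace hx hy
  by_cases h0 : rootSpace H ((α.1 : H → K) + (β.1 : H → K)) = ⊥
  · rw [h0, LieSubmodule.mem_bot] at hxy
    rw [hxy]
    exact zero_mem _
  let κ : Weight K H L := ⟨(α.1 : H → K) + (β.1 : H → K), h0⟩
  have hκ : ¬ κ.IsZero := by
    intro hκ
    have h : (α.1 : H → K) + (β.1 : H → K) = 0 := hκ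
    have hr : (ratRootSystem H).root α = -(ratRootSystem H).root β := by
      ext z
      exact eq_neg_of_add_eq_zero_left (congrFun h z)
    have := isCrystallographic_ratRootSystem (H := H)
    rw [isPos_iff_htFun] at hα hβ
    rw [hr, map_neg] at hα
    linarith
  let γ : H.root := ⟨κ, by simpa using hκ⟩
  exact rootSpace_le_rootSpaceSum (hI γ (ratRootSystem_root_eq_add_iff.mpr rfl)) hxy

lemma lie_mem_of_mem_rootSpaceSum {I J : Set H.root} {S : Submodule K L}
    (h : ∀ α ∈ I, ∀ β ∈ J, ∀ x ∈ rootSpace H (α.1 : H → K), ∀ y ∈ rootSpace H (β.1 : H → K),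
      ⁅x, y⁆ ∈ S) {x y : L} (hx : x ∈ rootSpaceSum H I) (hy : y ∈ rootSpaceSum H J) :
    ⁅x, y⁆ ∈ S := by
  have h1 : ∀ α ∈ I, ∀ x ∈ rootSpace H (α.1 : H → K),
      rootSpaceSum H J ≤ S.comap (LieAlgebra.ad K L x) :=
    fun α hα x hx ↦ iSup₂_le fun β hβ y hy ↦ h α hα β hβ x hx y hy
  have h2 : rootSpaceSum H I ≤ S.comap (LieAlgebra.ad K L y) := by
    refine iSup₂_le fun α hα x hx ↦ ?_
    rw [Submodule.mem_comap, LieAlgebra.ad_apply, ← lie_skew]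
    exact neg_mem (h1 α hα x hx hy)
  rw [← lie_skew]
  exact neg_mem (h2 hx)

lemma IsAbelianIdeal.lie_mem_rootSpaceSum {I : Set H.root} (hI : IsAbelianIdeal b I) {x y : L}
    (hx : x ∈ borel b) (hy : y ∈ rootSpaceSum H I) : ⁅x, y⁆ ∈ rootSpaceSum H I := by
  obtain ⟨h, hh, z, hz, rfl⟩ := Submodule.mem_sup.mp
    (show x ∈ H.toSubmodule ⊔ rootSpaceSum H {γ | b.IsPos γ} from hx)
  rw [add_lie]
  refine add_mem ?_ (lie_mem_of_mem_rootSpaceSum (fun α hα β hβ x hx y hy ↦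
    lie_mem_rootSpaceSum_of_forall hα (hI.pos β hβ) (fun κ hκ ↦ ?_) hx hy) hz hy)
  · have : rootSpaceSum H I ≤ (rootSpaceSum H I).comap (LieAlgebra.ad K L h) :=
      iSup₂_le fun β hβ y hy ↦ rootSpace_le_rootSpaceSum hβ
        ((rootSpace H (β.1 : H → K)).lie_mem (x := (⟨h, hh⟩ : H)) hy)
    exact this hy
  · exact hI.ideal β hβ α hα κ (by rw [hκ, add_comm])

lemma IsAbelianIdeal.lie_eq_zero {I : Set H.root} (hI : IsAbelianIdeal b I) {x y : L}
    (hx : x ∈ rootSpaceSum H I) (hy : y ∈ rootSpaceSum H I) : ⁅x, y⁆ = 0 := by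
  have : ⁅x, y⁆ ∈ rootSpaceSum H (∅ : Set H.root) :=
    lie_mem_of_mem_rootSpaceSum (fun α hα β hβ x hx y hy ↦
      lie_mem_rootSpaceSum_of_forall (hI.pos α hα) (hI.pos β hβ)
        (fun κ hκ ↦ (hI.abelian α hα β hβ ⟨κ, hκ⟩).elim) hx hy) hx hy
  simpa [rootSpaceSum] using this

lemma IsAbelianIdeal.rootSpaceSum_le_borel {I : Set H.root} (hI : IsAbelianIdeal b I) :
    rootSpaceSum H I ≤ (borel b).toSubmodule :=
  (iSup₂_le fun _ hα ↦ rootSpace_le_rootSpaceSum (hI.pos _ hα)).trans le_sup_right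

/-- The ideal of the Borel subalgebra attached to a combinatorial Abelian ideal. -/
def IsAbelianIdeal.toLieIdeal {I : Set H.root} (hI : IsAbelianIdeal b I) :
    LieIdeal K (borel b) where
  __ := (rootSpaceSum H I).comap (borel b).toSubmodule.subtype
  lie_mem {x _} hm := hI.lie_mem_rootSpaceSum x.2 hm

lemma IsAbelianIdeal.map_toLieIdeal {I : Set H.root} (hI : IsAbelianIdeal b I) :
    hI.toLieIdeal.toSubmodule.map (borel b).toSubmodule.subtype = rootSpaceSum H I := by
  change ((rootSpaceSum H I).comap (borel b).toSubmodule.subtype).map _ = _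
  rw [Submodule.map_comap_eq, Submodule.range_subtype, inf_eq_right]
  exact hI.rootSpaceSum_le_borel

lemma IsAbelianIdeal.isLieAbelian {I : Set H.root} (hI : IsAbelianIdeal b I) :
    IsLieAbelian hI.toLieIdeal where
  trivial x y := by
    apply Subtype.ext
    apply Subtype.ext
    exact hI.lie_eq_zero x.2 y.2

lemma rootSpaceSum_empty : rootSpaceSum H (∅ : Set H.root) = ⊥ := by
  simp [rootSpaceSum]

/-- The ideal is H-stable, hence a sum of root spaces. A nonzero bracket in L_(α+β) contradicts
commutativity when both roots occur, and forces the whole line L_(α+β) into the ideal when one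
occurs and the other is positive. -/
lemma exists_isAbelianIdeal_of_lieIdeal {J : Set H.root} (hJ : ∀ γ ∈ J, b.IsPos γ)
    (𝔞 : LieIdeal K (borel b)) (h0 : 𝔞 ≠ ⊥) (hab : IsLieAbelian 𝔞)
    (hsub : 𝔞.toSubmodule.map (borel b).toSubmodule.subtype ≤ rootSpaceSum H J) :
    ∃ I ∈ nontrivialIdeals b, I ⊆ J ∧
      𝔞.toSubmodule.map (borel b).toSubmodule.subtype = rootSpaceSum H I := by
  have hlie : ∀ x ∈ borel b, ∀ y ∈ 𝔞.toSubmodule.map (borel b).toSubmodule.subtype,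
      ⁅x, y⁆ ∈ 𝔞.toSubmodule.map (borel b).toSubmodule.subtype := by
    rintro x hx - ⟨y, hy, rfl⟩
    exact ⟨⁅(⟨x, hx⟩ : borel b), y⁆, 𝔞.lie_mem hy, rfl⟩
  have hzero : ∀ x ∈ 𝔞.toSubmodule.map (borel b).toSubmodule.subtype,
      ∀ y ∈ 𝔞.toSubmodule.map (borel b).toSubmodule.subtype, ⁅x, y⁆ = 0 := by
    rintro - ⟨x, hx, rfl⟩ - ⟨y, hy, rfl⟩
    have := hab.trivial ⟨x, hx⟩ ⟨y, hy⟩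
    exact congrArg (fun z : 𝔞 ↦ ((z : borel b) : L)) this
  let S : LieSubmodule K H L :=
    { 𝔞.toSubmodule.map (borel b).toSubmodule.subtype with
      lie_mem := fun {x m} hm ↦ hlie x (Submodule.mem_sup_left x.2) m hm }
  have hS : S.toSubmodule = 𝔞.toSubmodule.map (borel b).toSubmodule.subtype := rfl
  have hSI := eq_rootSpaceSum S hsub
  rw [hS] at hSI
  set A := 𝔞.toSubmodule.map (borel b).toSubmodule.subtype with hA
  have hIJ : {α : H.root | (rootSpace H (α.1 : H → K)).toSubmodule ≤ A} ⊆ J :=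
    fun α hα ↦ mem_of_rootSpace_le_rootSpaceSum (le_trans hα hsub)
  have hadd {α β κ : H.root}
      (h : (ratRootSystem H).root κ = (ratRootSystem H).root α + (ratRootSystem H).root β) :
      ∃ x ∈ rootSpace H (α.1 : H → K), ∃ y ∈ rootSpace H (β.1 : H → K), ⁅x, y⁆ ≠ 0 := by
    refine exists_lie_ne_zero α.1 β.1 (H.isNonZero_coe_root α) ?_
    rw [← ratRootSystem_root_eq_add_iff.mp h]
    exact κ.1.genWeightSpace_ne_bot
  refine ⟨_, ⟨⟨fun α hα ↦ hJ α (hIJ hα), ?_, ?_⟩, ?_⟩, hIJ, hSI⟩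
  · rintro α hα β hβ ⟨κ, hκ⟩
    obtain ⟨x, hx, y, hy, hxy⟩ := hadd hκ
    exact hxy (hzero x (hα hx) y (hβ hy))
  · intro α hα ν hν κ hκ
    obtain ⟨x, hx, y, hy, hxy⟩ := hadd (hκ.trans (add_comm _ _))
    refine rootSpace_le_of_mem κ ?_ hxy (hlie x ?_ y (hα hy))
    · rw [ratRootSystem_root_eq_add_iff.mp (hκ.trans (add_comm _ _))]
      exact lie_mem_genWeightSpace_of_mem_genWeightSpace hx hy
    · exact Submodule.mem_sup_right (rootSpace_le_rootSpaceSum hν hx)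
  · rw [Set.nonempty_iff_ne_empty]
    intro h
    rw [h, rootSpaceSum_empty, hA, ← Submodule.map_bot (borel b).toSubmodule.subtype] at hSI
    exact h0 ((LieSubmodule.toSubmodule_eq_bot 𝔞).mp
      (Submodule.map_injective_of_injective (Submodule.subtype_injective _) hSI))

lemma exists_equiv_lieIdeal {J : Set H.root} (hJ : ∀ γ ∈ J, b.IsPos γ) :
    ∃ g : {I // I ∈ nontrivialIdeals b ∧ I ⊆ J} ≃
      {𝔞 : LieIdeal K (borel b) // 𝔞 ≠ ⊥ ∧ IsLieAbelian 𝔞 ∧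
        𝔞.toSubmodule.map (borel b).toSubmodule.subtype ≤ rootSpaceSum H J},
      ∀ I, (g I).1.toSubmodule.map (borel b).toSubmodule.subtype = rootSpaceSum H I := by
  refine ⟨Equiv.ofBijective (fun I : {I // I ∈ nontrivialIdeals b ∧ I ⊆ J} ↦
      ⟨I.2.1.1.toLieIdeal, ?_, I.2.1.1.isLieAbelian, ?_⟩)
    ⟨fun I I' h ↦ ?_, ?_⟩, fun I ↦ I.2.1.1.map_toLieIdeal⟩
  · intro h
    have h1 := I.2.1.1.map_toLieIdeal
    rw [h, LieSubmodule.bot_toSubmodule, Submodule.map_bot, ← rootSpaceSum_empty (H := H)] at h1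
    exact I.2.1.2.ne_empty (rootSpaceSum_injective h1).symm
  · rw [I.2.1.1.map_toLieIdeal]
    exact iSup₂_le fun α hα ↦ rootSpace_le_rootSpaceSum (I.2.2 hα)
  · have h1 : I.2.1.1.toLieIdeal = I'.2.1.1.toLieIdeal := congrArg Subtype.val h
    apply Subtype.ext
    apply rootSpaceSum_injective
    rw [← I.2.1.1.map_toLieIdeal, h1, I'.2.1.1.map_toLieIdeal]
  · rintro ⟨𝔞, h0, hab, hsub⟩
    obtain ⟨I, hI, hIJ, h⟩ := exists_isAbelianIdeal_of_lieIdeal hJ 𝔞 h0 hab hsub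
    refine ⟨⟨I, hI, hIJ⟩, Subtype.ext ?_⟩
    rw [← hI.1.map_toLieIdeal] at h
    exact (LieSubmodule.toSubmodule_injective
      (Submodule.map_injective_of_injective (Submodule.subtype_injective _) h)).symm

end LieIdeals

end AbelianIdeals

open AbelianIdeals LieAlgebra in
theorem mainTheorem6 {K L : Type*} [Field K] [IsAlgClosed K] [CharZero K]
    [LieRing L] [LieAlgebra K L] [FiniteDimensional K L] [LieAlgebra.IsSimple K L]
    (H : LieSubalgebra K L) [H.IsCartanSubalgebra]
    (b : (ratRootSystem H).Base)
    (B : (ratRootSystem H).RootPositiveForm ℚ)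
    (θ : H.root) (hθ : IsHighestRoot b θ) :
    Set.BijOn (idealOf b) {w | IsMinuscule B b θ w ∧ w ≠ 1} (nontrivialIdeals b) ∧
    (∀ w, IsMinuscule B b θ w → w ≠ 1 →
      List.TFAE [
        ∃ μ ∈ longPos B b, IsMinIdeal B b θ μ (idealOf b w),
        idealOf b w ⊆ heisenbergRoots B b θ,
        ∃ w' ∈ finiteWeyl B b, w = w' * reflZero B θ]) ∧
    (∃ e : longPos B b ≃ {I // I ∈ nontrivialIdeals b ∧ I ⊆ heisenbergRoots B b θ},
      (∀ μ : longPos B b, IsMinIdeal B b θ μ (e μ)) ∧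
      ∃ f : longPos B b ≃ {𝔞 : LieIdeal K (borel b) // 𝔞 ≠ ⊥ ∧ IsLieAbelian 𝔞 ∧
          𝔞.toSubmodule.map (borel b).toSubmodule.subtype ≤
            rootSpaceSum H (heisenbergRoots B b θ)},
        ∀ μ : longPos B b, (f μ).1.toSubmodule.map (borel b).toSubmodule.subtype = rootSpaceSum H (e μ)) := by
  have := isCrystallographic_ratRootSystem (H := H)
  have := isReduced_ratRootSystem (H := H)
  obtain ⟨e, he⟩ := exists_longPos_equiv B hθ
  obtain ⟨g, hg⟩ := exists_equiv_lieIdeal (b := b) (J := heisenbergRoots B b θ) fun _ h ↦ h.1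
  exact ⟨bijOn_idealOf B hθ, fun w hw h1 ↦ hw.tfae hθ h1, e, he, e.trans g, fun μ ↦ hg (e μ)⟩
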